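/- **Notation.** For a category $\mathcal D$, $\Delta^{\circ}\mathcal D$ is the category of simplicial objects and $\Delta^{\circ}\Delta^{\circ}\mathcal D$ that of bisimplicial objects $Z=\{Z_{n,m}\}$ of $\mathcal D$; $\mathrm D:\Delta^{\circ}\Delta^{\circ}\mathcal D\to\Delta^{\circ}\mathcal D$, $(\mathrm DZ)_n=Z_{n,n}$, is the diagonal. For $A\in\mathcal D$, $A\times\Delta$ is the constant simplicial object; for $X\in\Delta^\circ\mathcal D$, $(X\times\Delta)_{n,m}=X_n$ and $(\Delta\times X)_{n,m}=X_m$. $\Upsilon$ is the automorphism of $\Delta^\circ\mathcal D$ induced by reversing the order of the ordinals $[n]$. If $\mathcal D$ has finite coproducts and a final object $*$, $\mathrm{Cyl}\,X$ is the simplicial object $\coprod_{\mathrm{Hom}([n],[1])}X_n$, with $d_0,d_1:X\to \mathrm{Cyl}\,X$ induced by $d^0,d^1:[0]\to[1]$; the cone $C(f)$ of $f:X\to Y$ in $\Delta^\circ\mathcal D$ is the pushout of $d_0\sqcup d_1:X\sqcup X\to \mathrm{Cyl}\,X$ along $f\sqcup \epsilon:X\sqcup X\to Y\sqcup *$, where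 $\epsilon:X\to *$. If $\mathrm E$ is a class of morphisms of $\mathcal D$, then $Fun(\mathcal C,\mathcal D)[\mathrm E^{-1}]$ is the localization of the functor category with respect to the objectwise $\mathrm E$-morphisms. **Simplicial descent categories.** A simplicial descent category is a tuple $(\mathcal D,\mathrm E,\mathbf s,\mu,\lambda)$, where - (S1) $\mathcal D$ is a category with finite coproducts (in particular an initial object) and a final object $*$; - (S2) $\mathrm E$ is a class of morphisms of $\mathcal D$ (the equivalences) which is saturated ($f\in\mathrm E$ if and only if $f$ becomes an isomorphism in $\mathcal D[\mathrm E^{-1}]$), and $f\sqcup g\in\mathrm E$ whenever $f,g\in\mathrm E$; an object $A$ is acyclic if $(A\to *)\in\mathrm E$; - (S3) $\mathbf s:\Delta^\circ\mathcal D\to\mathcal D$ is a functor such that the canonical morphism $\mathbf sX\sqcup\mathbf sY\to\mathbf s(X\sqcup Y)$ is in $\mathrm E$ for all $X,Y$; - (S4) $\mu:\mathbf s\mathrm D\to\mathbf s\mathbf s$ is an isomorphism of $Fun(\Delta^\circ\Delta^\circ\mathcal D,\mathcal D)[\mathrm E^{-1}]$, where $\mathbf s\mathbf sZ=\mathbf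 s(n\mapsto\mathbf s(m\mapsto Z_{n,m}))$; - (S5) $\lambda:\mathbf s(-\times\Delta)\to \mathrm{Id}_{\mathcal D}$ is a natural transformation with $\lambda_X\in\mathrm E$ for all $X$, there is a natural transformation $\rho:\mathrm{Id}_{\mathcal D}\to\mathbf s(-\times\Delta)$ with $\lambda\circ\rho=\mathrm{Id}$, and, writing $\mathrm R=\mathbf s(-\times\Delta)$, the compositions $$\mathbf sX\xrightarrow{\ \mu_{\Delta\times X}\ }\mathrm R\mathbf sX\xrightarrow{\ \lambda_{\mathbf sX}\ }\mathbf sX,\qquad \mathbf sX\xrightarrow{\ \mu_{X\times\Delta}\ }\mathbf s(n\mapsto \mathrm RX_n)\xrightarrow{\ \mathbf s(\lambda_X)\ }\mathbf sX$$ are the identity of $\mathbf s$ in $Fun(\Delta^\circ\mathcal D,\mathcal D)[\mathrm E^{-1}]$; - (S6) if $f$ is a morphism of $\Delta^\circ\mathcal D$ with $f_n\in\mathrm E$ for all $n$, then $\mathbf sf\in\mathrm E$; - (S7) a morphism $f$ of $\mathcal D$ is in $\mathrm E$ if and only if $\mathbf sC(f\times\Delta)$ is acyclic; - (S8) for each morphism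 $f$ of $\Delta^\circ\mathcal D$, $\mathbf s\Upsilon f\in\mathrm E$ if and only if $\mathbf sf\in\mathrm E$. **Descent functors.** A descent functor between simplicial descent categories $(\mathcal D,\mathrm E,\mathbf s,\mu,\lambda)$ and $(\mathcal D',\mathrm E',\mathbf s',\mu',\lambda')$ is a functor $\psi:\mathcal D\to\mathcal D'$ such that - (DF0) $\psi(\mathrm E)\subseteq\mathrm E'$; - (DF1) the canonical map $\psi(X)\sqcup\psi(Y)\to\psi(X\sqcup Y)$ is in $\mathrm E'$ for all $X,Y\in\mathcal D$; - (DF2) there is an isomorphism $\Theta:\psi\mathbf s\to\mathbf s'\psi$ of $Fun(\Delta^\circ\mathcal D,\mathcal D')[\mathrm E'^{-1}]$ such that $\lambda'_{\psi(X)}\Theta_{X\times\Delta}=\psi(\lambda_X)$ in $Fun(\mathcal D,\mathcal D')[\mathrm E'^{-1}]$, and $\mu'_{\psi Z}\,\Theta_{\mathrm DZ}=\mathbf s'(\Theta_Z)\,\Theta_{\mathbf sZ}\,\psi(\mu_Z)$ in $Fun(\Delta^\circ\Delta^\circ\mathcal D,\mathcal D')[\mathrm E'^{-1}]$. **Proposition.**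 Let $R$ be a ring and let $L$ be the functor from simplicial sets to simplicial $R$-modules that takes free $R$-modules degreewise. The homology of a simplicial $R$-module is that of its chain complex with boundary the alternating sum of the faces, and the homology of a simplicial set $W$ with coefficients in $R$ is that of $L(W)$. Let $\mathrm W$ be the class of morphisms of simplicial $R$-modules that induce isomorphisms on homology, and let $\mathrm E$ be the class of morphisms of simplicial sets that induce isomorphisms on homology with coefficients in $R$. Then the category $\Delta^\circ Set$ of simplicial sets, with $\mathrm E$ as equivalences, the diagonal $\mathrm D:\Delta^\circ\Delta^\circ Set\to\Delta^\circ Set$ as simple functor and the identity transformations as $\mu$ and $\lambda$, is a simplicial descent category. Moreover, $L$ is a descent functor from it to the simplicial descent category of simplicial $R$-modules with $\mathrm W$ as equivalences, the diagonal as simple functor and the identity transformations as $\mu$ and $\lambda$ (in particular, the latter is a simplicial descent category). -/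

import Mathlib

open CategoryTheory CategoryTheory.Limits Opposite

noncomputable section

namespace SimplicialDescent

universe u v v₁ v₂ v₃ v₄ u₁ u₂ u₃ u₄

/-! ### Morphisms of localized functor categories -/

section Localization

variable {A : Type u₁} [Category.{v₁} A] {B : Type u₂} [Category.{v₂} B]

/-- A functor `Φ : A ⥤ B` with `Φ(W) ⊆ W'` induces a functor `A[W⁻¹] ⥤ B[W'⁻¹]`; this is its
action on morphisms between (images of) objects of `A`. -/
def locMap {W : MorphismProperty A} {W' : MorphismProperty B} (Φ : A ⥤ B)
    (h : W ≤ W'.inverseImage Φ) {X Y : A} (φ : W.Q.obj X ⟶ W.Q.obj Y) :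
    W'.Q.obj (Φ.obj X) ⟶ W'.Q.obj (Φ.obj Y) :=
  (Localization.Construction.lift (Φ ⋙ W'.Q)
    (fun _ _ f hf ↦ Localization.inverts W'.Q W' _ (h f hf))).map φ

theorem locMap_Q_map {W : MorphismProperty A} {W' : MorphismProperty B} (Φ : A ⥤ B)
    (h : W ≤ W'.inverseImage Φ) {X Y : A} (f : X ⟶ Y) :
    locMap Φ h (W.Q.map f) = W'.Q.map (Φ.map f) := by
  have := Functor.congr_hom (Localization.Construction.fac (Φ ⋙ W'.Q)
    (fun _ _ f hf ↦ Localization.inverts W'.Q W' _ (h f hf))) f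
  exact this.trans ((Category.id_comp _).trans (Category.comp_id _))

end Localization

section FunctorLocalization

variable {C : Type u₁} [Category.{v₁} C] {D : Type u₂} [Category.{v₂} D]
  {C' : Type u₃} [Category.{v₃} C'] {D' : Type u₄} [Category.{v₄} D']

/-- `locFun E F` is the functor `F : C ⥤ D`, regarded as an object of the localization
`Fun(C, D)[E⁻¹]` of the functor category with respect to the objectwise `E`-morphisms. -/
abbrev locFun (E : MorphismProperty D) (F : C ⥤ D) : (E.functorCategory C).Localization :=
  (E.functorCategory C).Q.obj F

/-- The image in `Fun(C, D)[E⁻¹]` of a natural transformation. -/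
abbrev locNat (E : MorphismProperty D) {F G : C ⥤ D} (τ : F ⟶ G) :
    locFun E F ⟶ locFun E G :=
  (E.functorCategory C).Q.map τ

/-- Precomposition of a morphism `φ : F ⟶ F'` of `Fun(C, D)[E⁻¹]` with a functor `G : C' ⥤ C`.
Its components are `φ_{G(X)}`. -/
def locPrecomp {E : MorphismProperty D} {F F' : C ⥤ D} (G : C' ⥤ C)
    (φ : locFun E F ⟶ locFun E F') : locFun E (G ⋙ F) ⟶ locFun E (G ⋙ F') :=
  locMap (W := E.functorCategory C) (W' := E.functorCategory C')
    ((Functor.whiskeringLeft C' C D).obj G) (fun _ _ _ hf X ↦ hf (G.obj X)) φ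

/-- Postcomposition of a morphism `φ : F ⟶ F'` of `Fun(C, D)[E⁻¹]` with a functor `G : D ⥤ D'`
that preserves equivalences. Its components are `G(φ_X)`. -/
def locPostcomp {E : MorphismProperty D} {E' : MorphismProperty D'} {F F' : C ⥤ D} (G : D ⥤ D')
    (h : ∀ ⦃X Y : D⦄ (f : X ⟶ Y), E f → E' (G.map f))
    (φ : locFun E F ⟶ locFun E F') : locFun E' (F ⋙ G) ⟶ locFun E' (F' ⋙ G) :=
  locMap (W := E.functorCategory C) (W' := E'.functorCategory C)
    ((Functor.whiskeringRight C D D').obj G) (fun _ _ _ hf X ↦ h _ (hf X)) φ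

end FunctorLocalization

/-! ### Simplicial objects, diagonals, cylinders and cones -/

section SimplicialObjects

variable (D : Type u) [Category.{v} D]

/-- The diagonal functor from bisimplicial objects to simplicial objects,
`(biDiag Z)_n = Z_{n,n}`. -/
def biDiag : SimplicialObject (SimplicialObject D) ⥤ SimplicialObject D where
  obj Z :=
    { obj n := (Z.obj n).obj n
      map {n m} a := (Z.map a).app n ≫ (Z.obj m).map a }
  map {Z W} f := { app n := (f.app n).app n }

variable {D}

/-- The functor induced degreewise by `F` on simplicial objects. -/
abbrev simp {D' : Type u₁} [Category.{v₁} D'] (F : D ⥤ D') :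
    SimplicialObject D ⥤ SimplicialObject D' :=
  (SimplicialObject.whiskering D D').obj F

variable (D)

/-- The functor `X ↦ X × Δ`, `(X × Δ)_{n,m} = X_n`. -/
abbrev timesΔ : SimplicialObject D ⥤ SimplicialObject (SimplicialObject D) :=
  simp (SimplicialObject.const D)

/-- The functor `X ↦ Δ × X`, `(Δ × X)_{n,m} = X_m`. -/
abbrev Δtimes : SimplicialObject D ⥤ SimplicialObject (SimplicialObject D) :=
  SimplicialObject.const (SimplicialObject D)

/-- The identification of the diagonal of `X × Δ` with `X`. -/
def timesΔDiag : timesΔ D ⋙ biDiag D ≅ 𝟭 (SimplicialObject D) :=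
  NatIso.ofComponents (fun X ↦ NatIso.ofComponents (fun n ↦ Iso.refl (X.obj n))
    (fun {n m} a ↦ by
      change (X.map a ≫ 𝟙 _) ≫ 𝟙 _ = 𝟙 _ ≫ X.map a
      simp))
    (fun {X Y} f ↦ by
      ext n
      exact (Category.comp_id (f.app n)).trans (Category.id_comp (f.app n)).symm)

/-- The identification of the diagonal of `Δ × X` with `X`. -/
def ΔtimesDiag : Δtimes D ⋙ biDiag D ≅ 𝟭 (SimplicialObject D) :=
  NatIso.ofComponents (fun X ↦ NatIso.ofComponents (fun n ↦ Iso.refl (X.obj n))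
    (fun {n m} a ↦ by
      change (𝟙 _ ≫ X.map a) ≫ 𝟙 _ = 𝟙 _ ≫ X.map a
      simp))
    (fun {X Y} f ↦ by
      ext n
      exact (Category.comp_id (f.app n)).trans (Category.id_comp (f.app n)).symm)

variable {D}

/-- `F(X × Δ) = F(X) × Δ` for a functor `F` applied degreewise to a constant simplicial object. -/
def constSimp {D' : Type u₁} [Category.{v₁} D'] (F : D ⥤ D') :
    SimplicialObject.const D ⋙ simp F ≅ F ⋙ SimplicialObject.const D' :=
  NatIso.ofComponents (fun X ↦ Functor.constComp _ X F)
    (fun {X Y} f ↦ by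
      ext n
      exact (Category.comp_id (F.map f)).trans (Category.id_comp (F.map f)).symm)

/-- A functor applied (bi)degreewise commutes with the diagonal. -/
def diagSimp {D' : Type u₁} [Category.{v₁} D'] (F : D ⥤ D') :
    biDiag D ⋙ simp F ≅ simp (simp F) ⋙ biDiag D' :=
  NatIso.ofComponents (fun Z ↦ NatIso.ofComponents (fun n ↦ Iso.refl (F.obj ((Z.obj n).obj n)))
    (fun {n m} a ↦ by
      change F.map ((Z.map a).app n ≫ (Z.obj m).map a) ≫ 𝟙 _ =
        𝟙 _ ≫ F.map ((Z.map a).app n) ≫ F.map ((Z.obj m).map a)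
      simp))
    (fun {Z W} f ↦ by
      ext n
      exact (Category.comp_id (F.map ((f.app n).app n))).trans
        (Category.id_comp (F.map ((f.app n).app n))).symm)

instance [HasFiniteCoproducts D] : HasFiniteCoproducts (SimplicialObject D) :=
  inferInstanceAs (HasFiniteCoproducts (SimplexCategoryᵒᵖ ⥤ D))

section Cylinder

variable [HasFiniteCoproducts D]

instance (n : SimplexCategoryᵒᵖ) (A : D) :
    HasCoproduct (fun _ : (n.unop ⟶ SimplexCategory.mk 1) ↦ A) :=
  have := hasColimitsOfShape_discrete D (n.unop ⟶ SimplexCategory.mk 1)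
  inferInstance

/-- The simplicial cylinder `Cyl X = Δ[1] ⊠ X`: in degree `n`, it is the coproduct of copies of
`X_n` indexed by `Δ[1]_n = Hom([n], [1])`. -/
def cyl₀ (X : SimplicialObject D) : SimplicialObject D where
  obj n := ∐ fun _ : (n.unop ⟶ SimplexCategory.mk 1) ↦ X.obj n
  map {n m} a := Sigma.desc fun σ ↦
    X.map a ≫ Sigma.ι (fun _ : (m.unop ⟶ SimplexCategory.mk 1) ↦ X.obj m) (a.unop ≫ σ)

/-- The inclusion of the copy of `X_n` with index `σ ∈ Δ[1]_n` in degree `n` of `Cyl X`. -/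
def cylι (X : SimplicialObject D) {n : SimplexCategoryᵒᵖ} (σ : n.unop ⟶ SimplexCategory.mk 1) :
    X.obj n ⟶ (cyl₀ X).obj n :=
  Sigma.ι (fun _ : (n.unop ⟶ SimplexCategory.mk 1) ↦ X.obj n) σ

/-- The inclusion of `X` in `Cyl X` at the vertex `i` of `Δ[1]`. In the usual notation, the map
`d_0 : X ⟶ Cyl X` induced by `d^0 : [0] ⟶ [1]` is the inclusion at the vertex `1`,
and `d_1` is the inclusion at the vertex `0`. -/
def cylIncl (X : SimplicialObject D) (i : Fin 2) : X ⟶ cyl₀ X where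
  app n := cylι X (SimplexCategory.const _ _ i)
  naturality n m a := by
    simp only [cyl₀, cylι, Sigma.ι_desc]
    rfl

/-- The map `d_0 ⊔ d_1 : X ⊔ X ⟶ Cyl X`. -/
def cylEnds (X : SimplicialObject D) : X ⨿ X ⟶ cyl₀ X :=
  coprod.desc (cylIncl X 1) (cylIncl X 0)

/-- Morphisms out of the degree `n` part of a coproduct are determined on the two summands. -/
theorem coprod_app_ext {X Y : SimplicialObject D} {n : SimplexCategoryᵒᵖ} {T : D}
    {a b : (X ⨿ Y).obj n ⟶ T}
    (h₁ : (coprod.inl : X ⟶ X ⨿ Y).app n ≫ a = (coprod.inl : X ⟶ X ⨿ Y).app n ≫ b)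
    (h₂ : (coprod.inr : Y ⟶ X ⨿ Y).app n ≫ a = (coprod.inr : Y ⟶ X ⨿ Y).app n ≫ b) : a = b := by
  have hc := isColimitOfHasBinaryCoproductOfPreservesColimit
    ((evaluation SimplexCategoryᵒᵖ D).obj n) X Y
  exact BinaryCofan.IsColimit.hom_ext hc h₁ h₂

/-- Degreewise, `Cyl X` is the coproduct of the two ends and of copies of `X`, so that pushouts
along `d_0 ⊔ d_1` exist. -/
theorem hasPushout_app {X W : SimplicialObject D} (h : X ⨿ X ⟶ W) (n : SimplexCategoryᵒᵖ) :
    HasPushout ((cylEnds X).app n) (h.app n) := by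
  classical
  let I := { σ : (n.unop ⟶ SimplexCategory.mk 1) //
    σ ≠ SimplexCategory.const _ _ 1 ∧ σ ≠ SimplexCategory.const _ _ 0 }
  have := hasColimitsOfShape_discrete D I
  have ne : SimplexCategory.const n.unop (SimplexCategory.mk 1) 0 ≠
      SimplexCategory.const n.unop (SimplexCategory.mk 1) 1 := fun e ↦ by
    have := congrArg (fun g ↦ SimplexCategory.Hom.toOrderHom g 0) e
    exact absurd this (by simp [SimplexCategory.const])
  let P : D := W.obj n ⨿ ∐ fun _ : I ↦ X.obj n
  let c (σ : n.unop ⟶ SimplexCategory.mk 1) : X.obj n ⟶ P :=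
    if h1 : σ = SimplexCategory.const _ _ 1 then
      (coprod.inl : X ⟶ X ⨿ X).app n ≫ h.app n ≫ coprod.inl
    else if h0 : σ = SimplexCategory.const _ _ 0 then
      (coprod.inr : X ⟶ X ⨿ X).app n ≫ h.app n ≫ coprod.inl
    else Sigma.ι (fun _ : I ↦ X.obj n) ⟨σ, h1, h0⟩ ≫ coprod.inr
  have e₁ : (coprod.inl : X ⟶ X ⨿ X).app n ≫ (cylEnds X).app n = (cylIncl X 1).app n := by
    rw [← NatTrans.comp_app, cylEnds, coprod.inl_desc]
  have e₂ : (coprod.inr : X ⟶ X ⨿ X).app n ≫ (cylEnds X).app n = (cylIncl X 0).app n := by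
    rw [← NatTrans.comp_app, cylEnds, coprod.inr_desc]
  let inl : (cyl₀ X).obj n ⟶ P := Sigma.desc c
  have hinl (σ) : cylι X σ ≫ inl = c σ := Sigma.ι_desc _ _
  have hext {T : D} (a b : (cyl₀ X).obj n ⟶ T) (hab : ∀ σ, cylι X σ ≫ a = cylι X σ ≫ b) :
    a = b := Sigma.hom_ext _ _ hab
  have i₁ : (cylIncl X 1).app n ≫ inl = (coprod.inl : X ⟶ X ⨿ X).app n ≫ h.app n ≫ coprod.inl :=
    (hinl _).trans (by simp [c])
  have i₂ : (cylIncl X 0).app n ≫ inl = (coprod.inr : X ⟶ X ⨿ X).app n ≫ h.app n ≫ coprod.inl :=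
    (hinl _).trans (by simp [c, ne])
  have w : (cylEnds X).app n ≫ inl = h.app n ≫ coprod.inl := by
    apply coprod_app_ext
    · rw [← Category.assoc, e₁, i₁]
    · rw [← Category.assoc, e₂, i₂]
  refine ⟨⟨PushoutCocone.mk inl coprod.inl w, PushoutCocone.IsColimit.mk w
    (fun s ↦ coprod.desc s.inr (Sigma.desc fun σ : I ↦ cylι X σ.1 ≫ s.inl)) ?_ ?_ ?_⟩⟩
  · intro s
    have hs := s.condition
    refine hext _ _ fun σ ↦ ?_
    rw [← Category.assoc, hinl]
    by_cases h1 : σ = SimplexCategory.const _ _ 1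
    · subst h1
      simp only [c, dif_pos, Category.assoc, coprod.inl_desc]
      rw [← hs, ← Category.assoc, e₁]
      rfl
    · by_cases h0 : σ = SimplexCategory.const _ _ 0
      · subst h0
        simp only [c, dif_pos, dif_neg h1, Category.assoc, coprod.inl_desc]
        rw [← hs, ← Category.assoc, e₂]
        rfl
      · simp only [c, dif_neg h1, dif_neg h0, Category.assoc, coprod.inr_desc, Sigma.ι_desc]
  · intro s
    exact coprod.inl_desc _ _
  · intro s m hm₁ hm₂
    apply coprod.hom_ext
    · rw [hm₂, coprod.inl_desc]
    · refine Sigma.hom_ext _ _ fun σ ↦ ?_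
      rw [coprod.inr_desc, Sigma.ι_desc, ← hm₁, ← Category.assoc _ inl m, hinl]
      simp only [c, dif_neg σ.2.1, dif_neg σ.2.2, Category.assoc]
      rfl

instance {X W : SimplicialObject D} (h : X ⨿ X ⟶ W) : HasPushout (cylEnds X) h := by
  have (n : SimplexCategoryᵒᵖ) : HasColimit ((span (cylEnds X) h).flip.obj n) :=
    have : HasColimit (span (((span (cylEnds X) h).flip.obj n).map WalkingSpan.Hom.fst)
      (((span (cylEnds X) h).flip.obj n).map WalkingSpan.Hom.snd)) := hasPushout_app h n
    hasColimit_of_iso (diagramIsoSpan ((span (cylEnds X) h).flip.obj n))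
  exact functorCategoryHasColimit _

/-- The (double mapping) cylinder `Cyl(f, g)`, the pushout of `d_0 ⊔ d_1 : X ⊔ X ⟶ Cyl X` along
`f ⊔ g : X ⊔ X ⟶ Y ⊔ Z`. -/
def cyl {X Y Z : SimplicialObject D} (f : X ⟶ Y) (g : X ⟶ Z) : SimplicialObject D :=
  pushout (cylEnds X) (coprod.map f g)

/-- The simplicial cone `C(f) = Cyl(f, X ⟶ *)`. -/
def cone [HasTerminal D] {X Y : SimplicialObject D} (f : X ⟶ Y) : SimplicialObject D :=
  cyl f ({ app n := terminal.from (X.obj n) } : X ⟶ (SimplicialObject.const D).obj (⊤_ D))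

end Cylinder

end SimplicialObjects

/-! ### Simplicial descent categories -/

section DescentCategories

/-- The data `(E, s, μ, λ)` of a simplicial descent category structure on `D`. Here `mu` is a
morphism from `Z ↦ s(biDiag Z)` to `Z ↦ s(n ↦ s(m ↦ Z_{n,m}))` in the localized functor category. -/
structure DescentData (D : Type u) [Category.{v} D] where
  /-- the class of equivalences -/
  E : MorphismProperty D
  /-- the simple functor -/
  s : SimplicialObject D ⥤ D
  /-- the comparison `μ : s D ⟶ s s` -/
  mu : locFun E (biDiag D ⋙ s) ⟶ locFun E (simp s ⋙ s)
  /-- the transformation `λ : s(- × Δ) ⟶ Id` -/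
  lam : SimplicialObject.const D ⋙ s ⟶ 𝟭 D

variable {D : Type u} [Category.{v} D]

namespace DescentData

variable (d : DescentData D)

/-- The composition `s X ⟶ s s (Δ × X) = R s X ⟶ s X` of `μ_{Δ × X}` and `λ_{s X}`, as an
endomorphism of `s` in `Fun(Δ°D, D)[E⁻¹]`. -/
def compat₁ : locFun d.E d.s ⟶ locFun d.E d.s :=
  locNat d.E (F := d.s) (G := Δtimes D ⋙ biDiag D ⋙ d.s)
      (Functor.whiskerRight (ΔtimesDiag D).inv d.s) ≫
    locPrecomp (Δtimes D) d.mu ≫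
    locNat d.E (F := Δtimes D ⋙ simp d.s ⋙ d.s) (G := d.s ⋙ SimplicialObject.const D ⋙ d.s)
      (Functor.whiskerRight (constSimp d.s).hom d.s) ≫
    locNat d.E (F := d.s ⋙ SimplicialObject.const D ⋙ d.s) (G := d.s)
      (Functor.whiskerLeft d.s d.lam)

/-- The composition `s X ⟶ s s (X × Δ) = s (R X) ⟶ s X` of `μ_{X × Δ}` and `s(λ_X)`, as an
endomorphism of `s` in `Fun(Δ°D, D)[E⁻¹]`. -/
def compat₂ : locFun d.E d.s ⟶ locFun d.E d.s :=
  locNat d.E (F := d.s) (G := timesΔ D ⋙ biDiag D ⋙ d.s)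
      (Functor.whiskerRight (timesΔDiag D).inv d.s) ≫
    locPrecomp (timesΔ D) d.mu ≫
    locNat d.E (F := timesΔ D ⋙ simp d.s ⋙ d.s) (G := d.s)
      (Functor.whiskerRight ((SimplicialObject.whiskering D D).map d.lam) d.s)

end DescentData

/-- The axioms of a simplicial descent category. -/
structure IsSimplicialDescent (d : DescentData D) : Prop where
  /-- (S1) -/
  [hasFiniteCoproducts : HasFiniteCoproducts D]
  /-- (S1) -/
  [hasTerminal : HasTerminal D]
  /-- (S2) `E` is saturated -/
  saturated : ∀ {X Y : D} (f : X ⟶ Y), d.E f ↔ IsIso (d.E.Q.map f)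
  /-- (S2) `E` is stable by coproducts -/
  coprod_map : ∀ {X Y X' Y' : D} (f : X ⟶ Y) (g : X' ⟶ Y'),
    d.E f → d.E g → d.E (coprod.map f g)
  /-- (S3) `s` commutes with coproducts up to equivalence -/
  simple_coprod : ∀ X Y : SimplicialObject D, d.E (coprodComparison d.s X Y)
  /-- (S4) -/
  isIso_mu : IsIso d.mu
  /-- (S5) `λ` is an equivalence -/
  lam_mem : ∀ X : D, d.E (d.lam.app X)
  /-- (S5) `λ` is a natural retraction -/
  exists_section : ∃ ρ : 𝟭 D ⟶ SimplicialObject.const D ⋙ d.s, ρ ≫ d.lam = 𝟙 (𝟭 D)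
  /-- (S5) `λ` is compatible with `μ` -/
  compat₁ : d.compat₁ = 𝟙 (locFun d.E d.s)
  /-- (S5) `λ` is compatible with `μ` -/
  compat₂ : d.compat₂ = 𝟙 (locFun d.E d.s)
  /-- (S6) -/
  exact : ∀ {X Y : SimplicialObject D} (f : X ⟶ Y),
    (∀ n : SimplexCategoryᵒᵖ, d.E (f.app n)) → d.E (d.s.map f)
  /-- (S7) `f` is an equivalence if and only if the simple of its cone is acyclic -/
  acyclic : ∀ {A B : D} (f : A ⟶ B),
    d.E f ↔ d.E (terminal.from (d.s.obj (cone ((SimplicialObject.const D).map f))))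
  /-- (S8) for the inverse order functor -/
  inverse_order : ∀ {X Y : SimplicialObject D} (f : X ⟶ Y),
    d.E (d.s.map (_root_.SimplicialObject.opFunctor.map f)) ↔ d.E (d.s.map f)

/-! ### Descent functors -/

variable {D' : Type u₁} [Category.{v₁} D']

section

variable (d : DescentData D) (d' : DescentData D') (ψ : D ⥤ D')
  (Θ : locFun d'.E (d.s ⋙ ψ) ⟶ locFun d'.E (simp ψ ⋙ d'.s))

/-- `λ'_{ψ(X)} Θ_{X × Δ} = ψ(λ_X)` in `Fun(D, D')[E'⁻¹]`. -/
def CompatLam : Prop :=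
  locPrecomp (SimplicialObject.const D) Θ ≫
    locNat d'.E (F := SimplicialObject.const D ⋙ simp ψ ⋙ d'.s)
      (G := ψ ⋙ SimplicialObject.const D' ⋙ d'.s)
      (Functor.whiskerRight (constSimp ψ).hom d'.s) ≫
    locNat d'.E (F := ψ ⋙ SimplicialObject.const D' ⋙ d'.s) (G := ψ)
      (Functor.whiskerLeft ψ d'.lam) =
  locNat d'.E (F := SimplicialObject.const D ⋙ d.s ⋙ ψ) (G := ψ)
    (Functor.whiskerRight d.lam ψ)

/-- The functor `Fun(Δ°D, D') ⥤ Fun(Δ°Δ°D, D')` sending `F` to `Z ↦ s'(n ↦ F(Z_n))`. -/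
def simpleAfter (D : Type u) [Category.{v} D] (s' : SimplicialObject D' ⥤ D') :
    (SimplicialObject D ⥤ D') ⥤ (SimplicialObject (SimplicialObject D) ⥤ D') :=
  SimplicialObject.whiskering (SimplicialObject D) D' ⋙
    (Functor.whiskeringRight _ _ _).obj s'

/-- The composition `s'(Θ_Z) Θ_{s Z} ψ(μ_Z)` agrees with `μ'_{ψ Z} Θ_{D Z}` in
`Fun(Δ°Δ°D, D')[E'⁻¹]`. The hypotheses say that `ψ` preserves equivalences and that `s'` sends
degreewise equivalences to equivalences, so that `ψ(μ_Z)` and `s'(Θ_Z)` make sense. -/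
def CompatMu (hψ : ∀ ⦃X Y : D⦄ (f : X ⟶ Y), d.E f → d'.E (ψ.map f))
    (hs' : ∀ {X Y : SimplicialObject D'} (f : X ⟶ Y),
      (∀ n : SimplexCategoryᵒᵖ, d'.E (f.app n)) → d'.E (d'.s.map f)) : Prop :=
  locPrecomp (biDiag D) Θ ≫
    locNat d'.E (F := biDiag D ⋙ simp ψ ⋙ d'.s) (G := simp (simp ψ) ⋙ biDiag D' ⋙ d'.s)
      (Functor.whiskerRight (diagSimp ψ).hom d'.s) ≫
    locPrecomp (simp (simp ψ)) d'.mu =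
  locPostcomp ψ hψ d.mu ≫
    locPrecomp (simp d.s) Θ ≫
    locMap (W := d'.E.functorCategory (SimplicialObject D))
      (W' := d'.E.functorCategory (SimplicialObject (SimplicialObject D)))
      (simpleAfter D d'.s) (fun _ _ _ hf Z ↦ hs' _ (fun n ↦ hf (Z.obj n))) Θ

end

/-- The axioms of a descent functor between simplicial descent categories. -/
structure IsDescentFunctor {d : DescentData D} {d' : DescentData D'}
    (h : IsSimplicialDescent d) (h' : IsSimplicialDescent d') (ψ : D ⥤ D') : Prop where
  /-- (DF0) -/
  map_mem : ∀ ⦃X Y : D⦄ (f : X ⟶ Y), d.E f → d'.E (ψ.map f)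
  /-- (DF1) -/
  coprod_mem : haveI := h.hasFiniteCoproducts; haveI := h'.hasFiniteCoproducts
    ∀ X Y : D, d'.E (coprodComparison ψ X Y)
  /-- (DF2) -/
  exists_iso : ∃ Θ : locFun d'.E (d.s ⋙ ψ) ⟶ locFun d'.E (simp ψ ⋙ d'.s),
    IsIso Θ ∧ CompatLam d d' ψ Θ ∧ CompatMu d d' ψ Θ map_mem h'.exact

end DescentCategories

/-! ### Simplicial sets and simplicial modules -/

section Examples

variable (C : Type u) [Category.{v} C]

/-- The identity transformation `s(biDiag Z) = s s Z` when the simple functor is the diagonal: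
both sides are `Z_{n,n,n}` in degree `n`. -/
def diagMu : biDiag (SimplicialObject C) ⋙ biDiag C ≅ simp (biDiag C) ⋙ biDiag C :=
  NatIso.ofComponents (fun Z ↦ NatIso.ofComponents
    (fun n ↦ Iso.refl (((Z.obj n).obj n).obj n)) (fun {n m} a ↦ by
      change ((((Z.map a).app n ≫ (Z.obj m).map a).app n) ≫ ((Z.obj m).obj m).map a) ≫ 𝟙 _ =
        𝟙 _ ≫ ((Z.map a).app n).app n ≫ ((Z.obj m).map a).app n ≫ ((Z.obj m).obj m).map a
      simp))
    (fun {Z W} f ↦ by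
      ext n
      exact (Category.comp_id (((f.app n).app n).app n)).trans
        (Category.id_comp (((f.app n).app n).app n)).symm)

/-- The identity transformation `biDiag (X × Δ) = X`. -/
def diagLam : SimplicialObject.const (SimplicialObject C) ⋙ biDiag C ≅ 𝟭 (SimplicialObject C) :=
  ΔtimesDiag C

variable {C}

/-- The data on `Δ°C` given by a class of equivalences, the diagonal as simple functor and
identities as `μ` and `λ`. -/
def diagData (W : MorphismProperty (SimplicialObject C)) : DescentData (SimplicialObject C) where
  E := W
  s := biDiag C
  mu := locNat W (diagMu C).hom
  lam := (diagLam C).hom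

variable (R : Type u) [Ring R]

/-- The free module functor `L`, applied degreewise. -/
abbrev freeSimplicialModule : SimplicialObject (Type u) ⥤ SimplicialObject (ModuleCat.{u} R) :=
  simp (ModuleCat.free R)

/-- The quasi-isomorphisms of simplicial modules: the morphisms inducing isomorphisms on the
homology of the chain complexes given by the alternating sums of the faces. -/
def moduleQuasiIso : MorphismProperty (SimplicialObject (ModuleCat.{u} R)) :=
  (HomologicalComplex.quasiIso (ModuleCat.{u} R) (ComplexShape.down ℕ)).inverseImage
    (AlgebraicTopology.alternatingFaceMapComplex (ModuleCat.{u} R))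

/-- The morphisms of simplicial sets inducing isomorphisms on homology with coefficients in `R`. -/
def homologyIso : MorphismProperty (SimplicialObject (Type u)) :=
  (moduleQuasiIso R).inverseImage (freeSimplicialModule R)

end Examples

end SimplicialDescent

end

/-! Both categories are instances of one situation: `F : C ⥤ A` preserves finite colimits, `A` is
abelian, and a morphism of simplicial objects of `C` is an equivalence when `F` sends it to a
quasi-isomorphism. For simplicial sets `F` is the free module functor; for simplicial modules it is
the identity. As `μ` and `λ` are identities up to canonical isomorphism, the coherence axioms only
compare natural transformations with identity components. Saturation holds because homology groups
factor through the localization. The content is in (S6), (S7) and (S8).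

(S6), `simplicialQuasiIso_biDiag`, needs no total complex. The décalage `Dec X = X([0] * -)` in the
outer direction contracts onto the constant object at the outer degree zero of `X`, so the diagonal
of `Dec f` is a quasi-isomorphism. It surjects degreewise onto `X`; the kernel map is again a
degreewise quasi-isomorphism by the five lemma, and the long exact sequences of `0 ⟶ K ⟶ Dec X ⟶ X ⟶
0` allow induction on the homological degree (`isIso_homology_biDiag`).

(S7), `homologyEquiv_cone_iff`: the ends of the cylinder are included by a degreewise split
monomorphism, so after applying `F` and the diagonal the cone is a pushout along a monomorphism in
an abelian category. Attaching the two ends in succession (`quasiIsoOf_doubleCylinder_iff`) shows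
that the inclusion of the vertex is an equivalence exactly when `f` is.

(S8), `simplicialQuasiIso_biDiag_opFunctor_iff`: the object `X(p^op * q)` projects to both `X(p^op)`
and `X(q)`. Each projection is a deformation retraction when the remaining variable is fixed, so by
(S6) the diagonals of `X` and of its reversal are joined by a natural zigzag of quasi-isomorphisms.
-/

open CategoryTheory CategoryTheory.Limits Opposite

noncomputable section

namespace HomologicalComplex.HomologySequence

open ComposableArrows Abelian

variable {C : Type*} [Category* C] [Abelian C] {S₁ S₂ : ShortComplex (ChainComplex C ℕ)}

/-- The five lemma for the first terms of short exact sequences of chain complexes. -/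
theorem chainComplex_quasiIso_τ₁ (φ : S₁ ⟶ S₂) (hS₁ : S₁.ShortExact) (hS₂ : S₂.ShortExact)
    (h₂ : QuasiIso φ.τ₂) (h₃ : QuasiIso φ.τ₃) : QuasiIso φ.τ₁ := by
  rw [quasiIso_iff]
  intro j
  rw [quasiIsoAt_iff_isIso_homologyMap]
  have hij : (ComplexShape.down ℕ).Rel (j + 1) j := rfl
  refine isIso_of_epi_of_isIso_of_isIso_of_mono (composableArrows₅_exact hS₁ _ j hij).δ₀
    (composableArrows₅_exact hS₂ _ j hij).δ₀
    (δ₀Functor.map (mapComposableArrows₅ φ hS₁ hS₂ (j + 1) j hij)) ?_ ?_ ?_ ?_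
  · change Epi (homologyMap φ.τ₂ (j + 1))
    infer_instance
  · change IsIso (homologyMap φ.τ₃ (j + 1))
    infer_instance
  · change IsIso (homologyMap φ.τ₂ j)
    infer_instance
  · change Mono (homologyMap φ.τ₃ j)
    infer_instance

end HomologicalComplex.HomologySequence

namespace SimplicialDescent

universe u v v₁ v₂ v₃ v₄ u₁ u₂ u₃ u₄

open AlgebraicTopology Simplicial

/-! ### Quasi-isomorphisms, pushouts along monomorphisms, and double mapping cylinders -/

section ExactFunctor

variable {A : Type u} [Category.{v} A] [Abelian A] {B : Type u₁} [Category.{v₁} B] [Abelian B]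

/-- The morphisms of `B` sent to quasi-isomorphisms by a functor to chain complexes. -/
abbrev quasiIsoOf (N : B ⥤ ChainComplex A ℕ) : MorphismProperty B :=
  (HomologicalComplex.quasiIso A (ComplexShape.down ℕ)).inverseImage N

/-- The Mayer–Vietoris sequence of a pushout square. Exactness on the left needs only `i` mono,
since the first component of the map to the biproduct is `i`. -/
theorem shortExact_of_isPushout {X Y Z P : B} {i : X ⟶ Y} {g : X ⟶ Z} {k : Y ⟶ P} {r : Z ⟶ P}
    (sq : IsPushout i g k r) [Mono i] :
    sq.shortComplex.ShortExact where
  exact := sq.exact_shortComplex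
  mono_f := by
    have : Mono (biprod.lift i (-g) ≫ (biprod.fst : Y ⊞ Z ⟶ Y)) := by
      rw [biprod.lift_fst]
      infer_instance
    exact mono_of_mono (biprod.lift i (-g)) (biprod.fst : Y ⊞ Z ⟶ Y)
  epi_g := sq.epi_shortComplex_g

theorem isIso_desc_of_isColimit {Y Z YZ : B}
    {q₁ : Y ⟶ YZ} {q₀ : Z ⟶ YZ} (hq : IsColimit (BinaryCofan.mk q₁ q₀)) :
    IsIso (biprod.desc q₁ q₀) := by
  let E : Y ⊞ Z ≅ YZ := (BinaryBiproduct.isColimit Y Z).coconePointUniqueUpToIso hq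
  have hE₁ : biprod.inl ≫ E.hom = q₁ := IsColimit.comp_coconePointUniqueUpToIso_hom
    (BinaryBiproduct.isColimit Y Z) hq ⟨.left⟩
  have hE₀ : biprod.inr ≫ E.hom = q₀ := IsColimit.comp_coconePointUniqueUpToIso_hom
    (BinaryBiproduct.isColimit Y Z) hq ⟨.right⟩
  have : biprod.desc q₁ q₀ = E.hom := by
    apply biprod.hom_ext' <;> simp [hE₁, hE₀]
  rw [this]
  infer_instance

variable (N : B ⥤ ChainComplex A ℕ)

theorem quasiIsoOf_biprod_map [N.Additive] {X Y X' Y' : B} (f : X ⟶ Y) (g : X' ⟶ Y')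
    (hf : quasiIsoOf N f) (hg : quasiIsoOf N g) : quasiIsoOf N (biprod.map f g) := by
  change QuasiIso _ at hf hg
  change QuasiIso _
  rw [quasiIso_iff] at *
  intro n
  have h₁ := hf n
  have h₂ := hg n
  rw [quasiIsoAt_iff_isIso_homologyMap] at *
  let G : B ⥤ A := N ⋙ HomologicalComplex.homologyFunctor A (ComplexShape.down ℕ) n
  change IsIso (G.map f) at h₁
  change IsIso (G.map g) at h₂
  change IsIso (G.map (biprod.map f g))
  refine ⟨G.map biprod.fst ≫ inv (G.map f) ≫ G.map biprod.inl +
    G.map biprod.snd ≫ inv (G.map g) ≫ G.map biprod.inr, ?_, ?_⟩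
  · have e₁ : G.map (biprod.map f g) ≫ G.map biprod.fst = G.map biprod.fst ≫ G.map f := by
      rw [← G.map_comp, ← G.map_comp, biprod.map_fst]
    have e₂ : G.map (biprod.map f g) ≫ G.map biprod.snd = G.map biprod.snd ≫ G.map g := by
      rw [← G.map_comp, ← G.map_comp, biprod.map_snd]
    rw [Preadditive.comp_add, reassoc_of% e₁, reassoc_of% e₂, IsIso.hom_inv_id_assoc,
      IsIso.hom_inv_id_assoc, ← G.map_comp, ← G.map_comp, ← G.map_add, biprod.total, G.map_id]
  · have e₁ : G.map biprod.inl ≫ G.map (biprod.map f g) = G.map f ≫ G.map biprod.inl := by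
      rw [← G.map_comp, ← G.map_comp, biprod.inl_map]
    have e₂ : G.map biprod.inr ≫ G.map (biprod.map f g) = G.map g ≫ G.map biprod.inr := by
      rw [← G.map_comp, ← G.map_comp, biprod.inr_map]
    rw [Preadditive.add_comp, Category.assoc, Category.assoc, Category.assoc, Category.assoc, e₁,
      e₂, IsIso.inv_hom_id_assoc, IsIso.inv_hom_id_assoc, ← G.map_comp, ← G.map_comp, ← G.map_add,
      biprod.total, G.map_id]

/-- A map on one summand is a quasi-isomorphism if its sum with another one is. -/
theorem quasiIsoOf_of_biprod_map {X Y X' Y' : B} (f : X ⟶ Y)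
    (g : X' ⟶ Y') (h : quasiIsoOf N (biprod.map f g)) : quasiIsoOf N f :=
  MorphismProperty.of_retract (g := biprod.map f g)
    { i := Arrow.homMk (u := biprod.inl) (v := biprod.inl) (by simp)
      r := Arrow.homMk (u := biprod.fst) (v := biprod.fst) (by simp)
      retract := by apply Arrow.hom_ext <;> simp } h

variable [PreservesFiniteLimits N] [PreservesFiniteColimits N]

theorem quasiIsoOf_τ₁ [N.PreservesZeroMorphisms] {S₁ S₂ : ShortComplex B} (φ : S₁ ⟶ S₂)
    (hS₁ : S₁.ShortExact) (hS₂ : S₂.ShortExact) (h₂ : quasiIsoOf N φ.τ₂)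
    (h₃ : quasiIsoOf N φ.τ₃) : quasiIsoOf N φ.τ₁ :=
  HomologicalComplex.HomologySequence.chainComplex_quasiIso_τ₁ (N.mapShortComplex.map φ)
    (hS₁.map_of_exact N) (hS₂.map_of_exact N) h₂ h₃

theorem quasiIsoOf_τ₃ [N.PreservesZeroMorphisms] {S₁ S₂ : ShortComplex B} (φ : S₁ ⟶ S₂)
    (hS₁ : S₁.ShortExact) (hS₂ : S₂.ShortExact) (h₁ : quasiIsoOf N φ.τ₁)
    (h₂ : quasiIsoOf N φ.τ₂) : quasiIsoOf N φ.τ₃ :=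
  HomologicalComplex.HomologySequence.quasiIso_τ₃ (N.mapShortComplex.map φ)
    (hS₁.map_of_exact N) (hS₂.map_of_exact N) h₁ h₂

variable [N.Additive] {X Y Z P : B} {i : X ⟶ Y} {g : X ⟶ Z} {k : Y ⟶ P} {r : Z ⟶ P}

/-- Compare the Mayer–Vietoris sequence of the square with that of the trivial pushout of `i` along
`𝟙 X`: the maps on the first two terms are quasi-isomorphisms, hence so is the third, which is `k`.
The next lemma exchanges the roles of `i` and `g`. -/
theorem quasiIsoOf_inl_of_isPushout (sq : IsPushout i g k r) [Mono i]
    (hg : quasiIsoOf N g) : quasiIsoOf N k := by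
  have sq₀ : IsPushout i (𝟙 X) (𝟙 Y) i := IsPushout.of_vert_isIso ⟨by simp⟩
  let φ : sq₀.shortComplex ⟶ sq.shortComplex :=
    { τ₁ := 𝟙 X
      τ₂ := biprod.map (𝟙 Y) g
      τ₃ := k
      comm₁₂ := by
        change 𝟙 X ≫ biprod.lift i (-g) = biprod.lift i (-𝟙 X) ≫ biprod.map (𝟙 Y) g
        ext <;> simp
      comm₂₃ := by
        change biprod.map (𝟙 Y) g ≫ biprod.desc k r = biprod.desc (𝟙 Y) i ≫ k
        ext <;> simp [sq.w] }
  exact quasiIsoOf_τ₃ N φ (shortExact_of_isPushout sq₀) (shortExact_of_isPushout sq)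
    (MorphismProperty.id_mem _ _)
    (quasiIsoOf_biprod_map N _ _ (MorphismProperty.id_mem _ _) hg)

theorem quasiIsoOf_inr_of_isPushout (sq : IsPushout i g k r) [Mono i]
    (hi : quasiIsoOf N i) : quasiIsoOf N r := by
  have sq₀ : IsPushout (𝟙 X) g g (𝟙 Z) := IsPushout.of_horiz_isIso ⟨by simp⟩
  let φ : sq₀.shortComplex ⟶ sq.shortComplex :=
    { τ₁ := 𝟙 X
      τ₂ := biprod.map i (𝟙 Z)
      τ₃ := r
      comm₁₂ := by
        change 𝟙 X ≫ biprod.lift i (-g) = biprod.lift (𝟙 X) (-g) ≫ biprod.map i (𝟙 Z)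
        ext <;> simp
      comm₂₃ := by
        change biprod.map i (𝟙 Z) ≫ biprod.desc k r = biprod.desc g (𝟙 Z) ≫ r
        ext <;> simp [sq.w] }
  exact quasiIsoOf_τ₃ N φ (shortExact_of_isPushout sq₀) (shortExact_of_isPushout sq)
    (MorphismProperty.id_mem _ _)
    (quasiIsoOf_biprod_map N _ _ hi (MorphismProperty.id_mem _ _))

/-- The cobase change of a morphism `g` along a monomorphism is a quasi-isomorphism if and only if
`g` is. -/
theorem quasiIsoOf_iff_of_isPushout (sq : IsPushout i g k r) [Mono i] :
    quasiIsoOf N k ↔ quasiIsoOf N g := by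
  refine ⟨fun hk ↦ ?_, quasiIsoOf_inl_of_isPushout N sq⟩
  have : Mono r := (MorphismProperty.monomorphisms _).of_isPushout sq.flip ‹Mono i›
  let S₁ : ShortComplex B := ShortComplex.mk i (cokernel.π i) (by simp)
  let S₂ : ShortComplex B := ShortComplex.mk r (cokernel.π r) (by simp)
  have hS₁ : S₁.ShortExact := { exact := ShortComplex.exact_cokernel i }
  have hS₂ : S₂.ShortExact := { exact := ShortComplex.exact_cokernel r }
  let φ : S₁ ⟶ S₂ :=
    { τ₁ := g
      τ₂ := k
      τ₃ := cokernel.map i r g k sq.w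
      comm₁₂ := sq.w.symm
      comm₂₃ := by simp [S₁, S₂] }
  -- Pushouts preserve cokernels, so the converse is the five lemma for the cokernel sequences of
  -- `i` and `r`.
  have : IsIso φ.τ₃ := isIso_cokernel_map_of_isPushout sq
  exact quasiIsoOf_τ₁ N φ hS₁ hS₂ hk (MorphismProperty.of_isIso _ _)

/-- Let `Cyl` be a cylinder of `X` with ends `i₁` and `i₀`, and `K` the pushout of the inclusion of
the ends along `f ⊔ e : X ⊔ X ⟶ Y ⊔ Z`. If `i₀` is a quasi-isomorphism, then `Z ⟶ K` is one
if and only if `f` is. -/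
theorem quasiIsoOf_doubleCylinder_iff {X Y Z Cyl XX YZ K : B}
    {p₁ p₀ : X ⟶ XX} (hp : IsColimit (BinaryCofan.mk p₁ p₀))
    {q₁ : Y ⟶ YZ} {q₀ : Z ⟶ YZ} (hq : IsColimit (BinaryCofan.mk q₁ q₀))
    {j : XX ⟶ Cyl} [Mono j] {g : XX ⟶ YZ} {f : X ⟶ Y} {e : X ⟶ Z}
    (hf : p₁ ≫ g = f ≫ q₁) (he : p₀ ≫ g = e ≫ q₀) {k : Cyl ⟶ K} {r : YZ ⟶ K}
    (sq : IsPushout j g k r) [Mono p₀] (hi : quasiIsoOf N (p₀ ≫ j)) :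
    quasiIsoOf N (q₀ ≫ r) ↔ quasiIsoOf N f := by
  -- `K₀` is the mapping cylinder of `e`: only the end `p₀` is glued, so `r₀` is a quasi-isomorphism
  -- because `i₀ = p₀ ≫ j` is one.
  obtain ⟨K₀, k₀, r₀, sq₀⟩ :
      ∃ (K₀ : B) (k₀ : Cyl ⟶ K₀) (r₀ : Z ⟶ K₀), IsPushout (p₀ ≫ j) e k₀ r₀ :=
    ⟨_, _, _, IsPushout.of_hasPushout (p₀ ≫ j) e⟩
  obtain ⟨a, ha₁, ha₀⟩ : ∃ a : XX ⟶ X ⊞ Z, p₁ ≫ a = biprod.inl ∧ p₀ ≫ a = e ≫ biprod.inr := by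
    obtain ⟨a, h⟩ := BinaryCofan.IsColimit.desc' hp (biprod.inl : X ⟶ X ⊞ Z) (e ≫ biprod.inr)
    exact ⟨a, h⟩
  let b : X ⊞ Z ⟶ K₀ :=
    biprod.desc (p₁ ≫ j ≫ k₀) r₀
  have hext {T : B} {s t : XX ⟶ T} (h₁ : p₁ ≫ s = p₁ ≫ t) (h₂ : p₀ ≫ s = p₀ ≫ t) : s = t :=
    BinaryCofan.IsColimit.hom_ext hp h₁ h₂
  have w : j ≫ k₀ = a ≫ b := by
    apply hext
    · simp [b, reassoc_of% ha₁]
    · simpa [b, reassoc_of% ha₀] using sq₀.w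
  -- The same `K₀` seen as a pushout along both ends, the free end being glued by the identity. This
  -- makes `b : X ⊞ Z ⟶ K₀` a monomorphism.
  have sq₁ : IsPushout j a k₀ b := by
    refine ⟨⟨w⟩, ⟨PushoutCocone.IsColimit.mk _
      (fun s ↦ sq₀.desc s.inl (biprod.inr ≫ s.inr) ?_) ?_ ?_ ?_⟩⟩
    · rw [Category.assoc, s.condition, reassoc_of% ha₀]
    · intro s
      simp
    · intro s
      ext
      · simpa [b, reassoc_of% ha₁] using p₁ ≫= s.condition
      · simp [b]
    · intro s m h₁ h₂
      apply sq₀.hom_ext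
      · simpa using h₁
      · simp [b, ← h₂]
  let c : X ⊞ Z ⟶ YZ := biprod.desc (f ≫ q₁) q₀
  have hc : a ≫ c = g := by
    apply hext
    · simp [c, reassoc_of% ha₁, hf]
    · simp [c, reassoc_of% ha₀, he]
  let m : K₀ ⟶ K := sq₁.desc k (c ≫ r) (by rw [← Category.assoc, hc, sq.w])
  -- By pasting, the other end is attached by a pushout of `c`, which is `f ⊕ 𝟙` up to isomorphism;
  -- hence `m` is a quasi-isomorphism exactly when `f` is.
  have sq₂ : IsPushout b c m r := by
    refine IsPushout.of_top (h₁₁ := j) (v₁₁ := a) (v₁₂ := k₀) ?_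
      (by simp [m]) sq₁
    simpa [m, hc] using sq
  have : Mono b := (MorphismProperty.monomorphisms _).of_isPushout sq₁.flip ‹Mono j›
  have hm : quasiIsoOf N m ↔ quasiIsoOf N c := quasiIsoOf_iff_of_isPushout N sq₂
  have hcf : quasiIsoOf N c ↔ quasiIsoOf N f := by
    have := isIso_desc_of_isColimit hq
    have : c = biprod.map f (𝟙 Z) ≫ biprod.desc q₁ q₀ := by
      ext <;> simp [c]
    rw [this, (quasiIsoOf N).cancel_right_of_respectsIso]
    exact ⟨quasiIsoOf_of_biprod_map N _ _, fun h ↦ quasiIsoOf_biprod_map N _ _ h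
      (MorphismProperty.id_mem _ _)⟩
  have hr : q₀ ≫ r = r₀ ≫ m := by
    have := biprod.inr ≫= sq₂.w
    simpa [b, c] using this.symm
  rw [hr, ← hcf, ← hm]
  exact (quasiIsoOf N).precomp_iff _ _ (quasiIsoOf_inr_of_isPushout N sq₀ hi)

end ExactFunctor

/-! ### Exactness of the alternating face map complex -/

section SimplicialQuasiIso

variable (A : Type u) [Category.{v} A] [Abelian A]

/-- The quasi-isomorphisms of simplicial objects of an abelian category. -/
abbrev simplicialQuasiIso : MorphismProperty (SimplicialObject A) :=
  quasiIsoOf (alternatingFaceMapComplex A)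

/-- The homology in degree `n` of a simplicial object of an abelian category. -/
abbrev simplicialHomology (n : ℕ) : SimplicialObject A ⥤ A :=
  alternatingFaceMapComplex A ⋙ HomologicalComplex.homologyFunctor A (ComplexShape.down ℕ) n

variable {A}

theorem simplicialQuasiIso_iff {X Y : SimplicialObject A} (f : X ⟶ Y) :
    simplicialQuasiIso A f ↔ ∀ n, IsIso ((simplicialHomology A n).map f) := by
  change QuasiIso _ ↔ _
  rw [quasiIso_iff]
  exact forall_congr' fun n ↦ quasiIsoAt_iff_isIso_homologyMap _ _

instance : (alternatingFaceMapComplex A).Additive where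
  map_add := by
    intros
    ext
    rfl

/-- Limits of complexes and of simplicial objects are both computed degreewise, and degree `n` of
the complex is evaluation at `[n]`. The same argument applies to colimits. -/
instance : PreservesFiniteLimits (alternatingFaceMapComplex A) where
  preservesFiniteLimits J _ _ := HomologicalComplex.preservesLimitsOfShape_of_eval _ fun n ↦
    inferInstanceAs (PreservesLimitsOfShape J
      ((evaluation SimplexCategoryᵒᵖ A).obj (op (SimplexCategory.mk n))))

instance : PreservesFiniteColimits (alternatingFaceMapComplex A) where
  preservesFiniteColimits J _ _ := HomologicalComplex.preservesColimitsOfShape_of_eval _ fun n ↦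
    inferInstanceAs (PreservesColimitsOfShape J
      ((evaluation SimplexCategoryᵒᵖ A).obj (op (SimplexCategory.mk n))))

end SimplicialQuasiIso

/-! ### Homotopies parametrized by `Δ[1]` and their effect on homology -/

section IntervalHomotopy

variable {C : Type u} [Category.{v} C]

/-- A homotopy `Δ[1] × X ⟶ Y` from `f` to `g`, as a family of morphisms `X_n ⟶ Y_n` indexed by
the simplices of `Δ[1]`. -/
structure IntervalHomotopy {X Y : SimplicialObject C} (f g : X ⟶ Y) where
  /-- the component at an `n`-simplex of `Δ[1]` -/
  h (n : SimplexCategoryᵒᵖ) (τ : n.unop ⟶ ⦋1⦌) : X.obj n ⟶ Y.obj n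
  naturality {n m : SimplexCategoryᵒᵖ} (a : n ⟶ m) (τ : n.unop ⟶ ⦋1⦌) :
    X.map a ≫ h m (a.unop ≫ τ) = h n τ ≫ Y.map a
  h_zero (n : SimplexCategoryᵒᵖ) : h n (SimplexCategory.const _ _ 0) = f.app n
  h_one (n : SimplexCategoryᵒᵖ) : h n (SimplexCategory.const _ _ 1) = g.app n

namespace IntervalHomotopy

variable {X Y : SimplicialObject C} {f g : X ⟶ Y} (H : IntervalHomotopy f g)

/-- The homotopy induced by a functor. -/
def map {D : Type u₁} [Category.{v₁} D] (F : C ⥤ D) :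
    IntervalHomotopy ((simp F).map f) ((simp F).map g) where
  h n τ := F.map (H.h n τ)
  naturality a τ := by
    change F.map _ ≫ F.map _ = F.map _ ≫ F.map _
    rw [← F.map_comp, H.naturality, F.map_comp]
  h_zero n := congrArg F.map (H.h_zero n)
  h_one n := congrArg F.map (H.h_one n)

/-- The homotopy induced on diagonals by a homotopy in the outer simplicial direction. -/
def diag {X Y : SimplicialObject (SimplicialObject C)} {f g : X ⟶ Y} (H : IntervalHomotopy f g) :
    IntervalHomotopy ((biDiag C).map f) ((biDiag C).map g) where
  h n τ := (H.h n τ).app n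
  naturality {n m} a τ := by
    change ((X.map a).app n ≫ (X.obj m).map a) ≫ (H.h m (a.unop ≫ τ)).app m =
      (H.h n τ).app n ≫ (Y.map a).app n ≫ (Y.obj m).map a
    have e := congrArg (fun k ↦ NatTrans.app k n) (H.naturality a τ)
    change (X.map a).app n ≫ (H.h m (a.unop ≫ τ)).app n =
      (H.h n τ).app n ≫ (Y.map a).app n at e
    rw [Category.assoc, (H.h m (a.unop ≫ τ)).naturality, reassoc_of% e]
  h_zero n := congrArg (fun k ↦ NatTrans.app k n) (H.h_zero n)
  h_one n := congrArg (fun k ↦ NatTrans.app k n) (H.h_one n)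

/-- Naturality of `H` moves the face to the source, so that the identities of a combinatorial
homotopy reduce to identities in the simplex category. The next two lemmas do the same for the other
operators. -/
theorem σ_comp_h_comp_δ {n : ℕ} (i : Fin (n + 1)) (k : Fin (n + 2)) (τ : ⦋n + 1⦌ ⟶ ⦋1⦌) :
    (X.σ i ≫ H.h (op ⦋n + 1⦌) τ) ≫ Y.δ k =
      X.map (SimplexCategory.δ k ≫ SimplexCategory.σ i).op ≫
        H.h (op ⦋n⦌) (SimplexCategory.δ k ≫ τ) := by
  have := H.naturality (SimplexCategory.δ k).op τ
  rw [op_comp, X.map_comp, Category.assoc, Category.assoc]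
  exact congrArg (X.σ i ≫ ·) this.symm

theorem σ_comp_h_comp_σ {n : ℕ} (i : Fin (n + 1)) (k : Fin (n + 2)) (τ : ⦋n + 1⦌ ⟶ ⦋1⦌) :
    (X.σ i ≫ H.h (op ⦋n + 1⦌) τ) ≫ Y.σ k =
      X.map (SimplexCategory.σ k ≫ SimplexCategory.σ i).op ≫
        H.h (op ⦋n + 2⦌) (SimplexCategory.σ k ≫ τ) := by
  have := H.naturality (SimplexCategory.σ k).op τ
  rw [op_comp, X.map_comp, Category.assoc, Category.assoc]
  exact congrArg (X.σ i ≫ ·) this.symm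

theorem map_comp_h {n m : ℕ} (a : ⦋m⦌ ⟶ ⦋n⦌) (i : Fin (m + 1)) (τ : ⦋m + 1⦌ ⟶ ⦋1⦌) :
    X.map a.op ≫ X.σ i ≫ H.h (op ⦋m + 1⦌) τ =
      X.map (SimplexCategory.σ i ≫ a).op ≫ H.h (op ⦋m + 1⦌) τ := by
  rw [op_comp, X.map_comp, Category.assoc]
  rfl

theorem toMk₁_zero (n : ℕ) :
    SimplexCategory.toMk₁ (n := n) 0 = SimplexCategory.const _ _ 1 := by
  refine ConcreteCategory.hom_ext _ _ fun k ↦ ?_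
  exact SimplexCategory.toMk₁_of_le_castSucc _ _ (Fin.zero_le _)

theorem toMk₁_last (n : ℕ) :
    SimplexCategory.toMk₁ (n := n) (Fin.last _) = SimplexCategory.const _ _ 0 := by
  refine ConcreteCategory.hom_ext _ _ fun k ↦ ?_
  exact SimplexCategory.toMk₁_of_castSucc_lt _ _ (Fin.castSucc_lt_last _)

/-- The associated combinatorial homotopy. -/
def toHomotopy : SimplicialObject.Homotopy f g where
  -- The simplex of `Δ[1]` used here is `0` on `0, …, i` and `1` on `i + 1, …, n + 1`: together with
  -- `σ i` it is the `i`-th top-dimensional simplex of the prism `Δ[n] × Δ[1]`.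
  h {n} i := X.σ i ≫ H.h (op ⦋n + 1⦌) (SimplexCategory.toMk₁ i.succ.castSucc)
  h_zero_comp_δ_zero n := by
    have e : SimplexCategory.δ (n := n) 0 ≫ SimplexCategory.σ 0 = 𝟙 _ :=
      SimplexCategory.δ_comp_σ_self (i := 0)
    rw [σ_comp_h_comp_δ, e, SimplexCategory.δ_comp_toMk₁_of_lt _ _ (by simp), ← H.h_one]
    simp [← toMk₁_zero]
  h_last_comp_δ_last n := by
    have e : SimplexCategory.δ (Fin.last (n + 1)) ≫ SimplexCategory.σ (Fin.last n) = 𝟙 _ :=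
      SimplexCategory.δ_comp_σ_succ (i := Fin.last n)
    rw [σ_comp_h_comp_δ, e, SimplexCategory.δ_comp_toMk₁_of_le _ _ (by simp), ← H.h_zero]
    simp [← toMk₁_last]
  h_succ_comp_δ_castSucc_of_lt {n} i j hij := by
    rw [σ_comp_h_comp_δ]
    erw [map_comp_h]
    rw [SimplexCategory.δ_comp_σ_of_le hij, SimplexCategory.δ_comp_toMk₁_of_lt _ _
      (by simp only [Fin.lt_def, Fin.le_def] at *; simp at *; omega)]
    rfl
  h_succ_comp_δ_castSucc_succ {n} j := by
    have e₁ := SimplexCategory.δ_comp_σ_self (i := j.succ)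
    have e₂ := SimplexCategory.δ_comp_σ_succ (i := j.castSucc)
    rw [← Fin.succ_castSucc] at e₁
    rw [σ_comp_h_comp_δ, σ_comp_h_comp_δ, ← Fin.succ_castSucc, e₁, e₂,
      SimplexCategory.δ_comp_toMk₁_of_lt _ _ (by simp [Fin.lt_def]),
      SimplexCategory.δ_comp_toMk₁_of_le _ _ (by simp)]
    rfl
  h_castSucc_comp_δ_succ_of_lt {n} i j hji := by
    rw [σ_comp_h_comp_δ]
    erw [map_comp_h]
    rw [SimplexCategory.δ_comp_σ_of_gt hji, SimplexCategory.δ_comp_toMk₁_of_le _ _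
      (by simp only [Fin.lt_def, Fin.le_def] at *; simp at *; omega)]
    rfl
  h_comp_σ_castSucc_of_le {n} i j hij := by
    rw [σ_comp_h_comp_σ]
    erw [map_comp_h]
    rw [SimplexCategory.σ_comp_σ hij, SimplexCategory.σ_comp_toMk₁_of_lt _ _
      (by simp only [Fin.lt_def, Fin.le_def] at *; simp at *; omega)]
    rfl
  h_comp_σ_succ_of_lt {n} i j hji := by
    rw [σ_comp_h_comp_σ]
    erw [map_comp_h]
    rw [← SimplexCategory.σ_comp_σ hji, SimplexCategory.σ_comp_toMk₁_of_le _ _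
      (by simp only [Fin.le_def] at *; simp at *; omega)]
    rfl

theorem map_simplicialHomology_eq [Abelian C] {X Y : SimplicialObject C} {f g : X ⟶ Y}
    (H : IntervalHomotopy f g) (n : ℕ) :
    (simplicialHomology C n).map f = (simplicialHomology C n).map g :=
  H.toHomotopy.map_homology_eq n

end IntervalHomotopy

variable {A : Type u} [Category.{v} A] [Abelian A] {X Y : SimplicialObject A}
  {r : X ⟶ Y} {s : Y ⟶ X}

/-- A retraction onto `Y` that is a deformation retraction is a quasi-isomorphism. -/
theorem simplicialQuasiIso_of_retraction (hs : s ≫ r = 𝟙 Y) (H : IntervalHomotopy (r ≫ s) (𝟙 X)) :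
    simplicialQuasiIso A r := by
  rw [simplicialQuasiIso_iff]
  intro n
  have e₁ := (simplicialHomology A n).congr_map hs
  have e₂ := H.map_simplicialHomology_eq n
  rw [CategoryTheory.Functor.map_comp, CategoryTheory.Functor.map_id] at e₁ e₂
  exact ⟨_, e₂, e₁⟩

/-- The inclusion of a deformation retract is a quasi-isomorphism. -/
theorem simplicialQuasiIso_of_section (hs : s ≫ r = 𝟙 Y) (H : IntervalHomotopy (r ≫ s) (𝟙 X)) :
    simplicialQuasiIso A s := by
  rw [simplicialQuasiIso_iff]
  intro n
  have e₁ := (simplicialHomology A n).congr_map hs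
  have e₂ := H.map_simplicialHomology_eq n
  rw [CategoryTheory.Functor.map_comp, CategoryTheory.Functor.map_id] at e₁ e₂
  exact ⟨_, e₁, e₂⟩

end IntervalHomotopy

/-! ### Joins `p^op * q` of finite ordinals and their contractions -/

namespace Join

variable {p q r : SimplexCategory}

/-- The join of two finite ordinals. -/
def ordJoin (p q : SimplexCategory) : SimplexCategory := SimplexCategory.mk (p.len + 1 + q.len)

/-- The inclusion of the first factor of a join. -/
def inl (p q : SimplexCategory) : p ⟶ ordJoin p q :=
  SimplexCategory.Hom.mk (b := ordJoin p q)
    ⟨fun i ↦ Fin.castAdd (q.len + 1) i, fun _ _ h ↦ h⟩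

/-- The inclusion of the second factor of a join. -/
def inr (p q : SimplexCategory) : q ⟶ ordJoin p q :=
  SimplexCategory.Hom.mk (b := ordJoin p q)
    ⟨fun i ↦ Fin.natAdd (p.len + 1) i, fun i j h ↦ Nat.add_le_add_left (n := i) (m := j) h _⟩

/-- The values of `f` are bounded above by those of `g`. -/
def Below (f : p ⟶ r) (g : q ⟶ r) : Prop := ∀ x y, f.toOrderHom x ≤ g.toOrderHom y

/-- The morphism from a join given by a morphism on each factor. -/
def desc (f : p ⟶ r) (g : q ⟶ r) (h : Below f g) : ordJoin p q ⟶ r :=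
  SimplexCategory.Hom.mk (a := ordJoin p q)
    ⟨Fin.addCases (m := p.len + 1) (n := q.len + 1) f.toOrderHom g.toOrderHom, by
      intro i j hij
      dsimp only
      induction i using Fin.addCases (m := p.len + 1) (n := q.len + 1) with
      | left i =>
        induction j using Fin.addCases (m := p.len + 1) (n := q.len + 1) with
        | left j =>
          rw [Fin.addCases_left, Fin.addCases_left]
          exact f.toOrderHom.monotone hij
        | right j =>
          rw [Fin.addCases_left, Fin.addCases_right]
          exact h i j
      | right i =>
        induction j using Fin.addCases (m := p.len + 1) (n := q.len + 1) with
        | left j =>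
          exfalso
          have := Fin.le_def.1 hij
          simp at this
          omega
        | right j =>
          rw [Fin.addCases_right, Fin.addCases_right]
          exact g.toOrderHom.monotone ((Fin.natAdd_le_natAdd_iff _).1 hij)⟩

theorem hom_ext {f g : ordJoin p q ⟶ r} (h₁ : inl p q ≫ f = inl p q ≫ g)
    (h₂ : inr p q ≫ f = inr p q ≫ g) : f = g := by
  refine ConcreteCategory.hom_ext _ _ fun (i : Fin (p.len + 1 + (q.len + 1))) ↦ ?_
  induction i using Fin.addCases with
  | left i => exact ConcreteCategory.congr_hom h₁ i
  | right i => exact ConcreteCategory.congr_hom h₂ i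

@[simp]
theorem inl_desc (f : p ⟶ r) (g : q ⟶ r) (h : Below f g) : inl p q ≫ desc f g h = f := by
  refine ConcreteCategory.hom_ext _ _ fun i ↦ ?_
  exact Fin.addCases_left (motive := fun _ ↦ Fin (r.len + 1)) (m := p.len + 1) (n := q.len + 1)
    (left := f.toOrderHom) (right := g.toOrderHom) i

@[simp]
theorem inl_desc_assoc (f : p ⟶ r) (g : q ⟶ r) (h : Below f g) {T : SimplexCategory} (k : _ ⟶ T) :
    inl p q ≫ desc f g h ≫ k = (f) ≫ k := by
  rw [← Category.assoc, inl_desc]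

@[simp]
theorem inr_desc (f : p ⟶ r) (g : q ⟶ r) (h : Below f g) : inr p q ≫ desc f g h = g := by
  refine ConcreteCategory.hom_ext _ _ fun i ↦ ?_
  exact Fin.addCases_right (motive := fun _ ↦ Fin (r.len + 1)) (m := p.len + 1) (n := q.len + 1)
    (left := f.toOrderHom) (right := g.toOrderHom) i

@[simp]
theorem inr_desc_assoc (f : p ⟶ r) (g : q ⟶ r) (h : Below f g) {T : SimplexCategory} (k : _ ⟶ T) :
    inr p q ≫ desc f g h ≫ k = (g) ≫ k := by
  rw [← Category.assoc, inr_desc]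

theorem below_inl_inr {p' q' : SimplexCategory} (a : p' ⟶ p) (b : q' ⟶ q) :
    Below (a ≫ inl p q) (b ≫ inr p q) := by
  intro x y
  change Fin.castAdd _ _ ≤ Fin.natAdd _ _
  simp [Fin.le_def]
  omega

/-- The functor `(p, q) ↦ p^op * q`. -/
def opJoin : SimplexCategory ⥤ SimplexCategory ⥤ SimplexCategory where
  obj p :=
    { obj q := ordJoin (SimplexCategory.rev.obj p) q
      map b := desc (𝟙 _ ≫ inl _ _) (b ≫ inr _ _) (below_inl_inr _ _)
      map_id _ := hom_ext (by simp) (by simp)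
      map_comp _ _ := hom_ext (by simp) (by simp) }
  map a :=
    { app q := desc (SimplexCategory.rev.map a ≫ inl _ _) (𝟙 _ ≫ inr _ _) (below_inl_inr _ _)
      naturality _ _ _ := hom_ext (by simp) (by simp) }
  map_id _ := by
    ext q : 2
    exact hom_ext (by simp) (by simp)
  map_comp _ _ := by
    ext q : 2
    exact hom_ext (by simp) (by simp)

/-- The inclusion of `p^op` in `p^op * q`. -/
def opInl (p q : SimplexCategory) : SimplexCategory.rev.obj p ⟶ (opJoin.obj p).obj q := inl _ _

/-- The inclusion of `q` in `p^op * q`. -/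
def opInr (p q : SimplexCategory) : q ⟶ (opJoin.obj p).obj q := inr _ _

theorem opJoin_hom_ext {f g : (opJoin.obj p).obj q ⟶ r} (h₁ : opInl p q ≫ f = opInl p q ≫ g)
    (h₂ : opInr p q ≫ f = opInr p q ≫ g) : f = g := hom_ext h₁ h₂

@[simp]
theorem opInl_map {q' : SimplexCategory} (b : q ⟶ q') :
    opInl p q ≫ (opJoin.obj p).map b = opInl p q' :=
  (inl_desc _ _ (below_inl_inr _ _)).trans (Category.id_comp (opInl p q'))

@[simp]
theorem opInl_map_assoc {q' : SimplexCategory} (b : q ⟶ q') {T : SimplexCategory} (k : _ ⟶ T) :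
    opInl p q ≫ (opJoin.obj p).map b ≫ k = (opInl p q') ≫ k := by
  rw [← Category.assoc, opInl_map]

@[simp]
theorem opInr_map {q' : SimplexCategory} (b : q ⟶ q') :
    opInr p q ≫ (opJoin.obj p).map b = b ≫ opInr p q' :=
  inr_desc _ _ (below_inl_inr _ _)

@[simp]
theorem opInr_map_assoc {q' : SimplexCategory} (b : q ⟶ q') {T : SimplexCategory} (k : _ ⟶ T) :
    opInr p q ≫ (opJoin.obj p).map b ≫ k = (b ≫ opInr p q') ≫ k := by
  rw [← Category.assoc, opInr_map]

@[simp]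
theorem opInl_map_app {p' : SimplexCategory} (a : p ⟶ p') :
    opInl p q ≫ (opJoin.map a).app q = SimplexCategory.rev.map a ≫ opInl p' q :=
  inl_desc _ _ (below_inl_inr _ _)

@[simp]
theorem opInl_map_app_assoc {p' : SimplexCategory} (a : p ⟶ p') {T : SimplexCategory} (k : _ ⟶ T) :
    opInl p q ≫ (opJoin.map a).app q ≫ k = (SimplexCategory.rev.map a ≫ opInl p' q) ≫ k := by
  rw [← Category.assoc, opInl_map_app]

@[simp]
theorem opInr_map_app {p' : SimplexCategory} (a : p ⟶ p') :
    opInr p q ≫ (opJoin.map a).app q = opInr p' q :=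
  (inr_desc _ _ (below_inl_inr _ _)).trans (Category.id_comp (opInr p' q))

@[simp]
theorem opInr_map_app_assoc {p' : SimplexCategory} (a : p ⟶ p') {T : SimplexCategory} (k : _ ⟶ T) :
    opInr p q ≫ (opJoin.map a).app q ≫ k = (opInr p' q) ≫ k := by
  rw [← Category.assoc, opInr_map_app]

theorem opInl_le_opInr (x : Fin ((SimplexCategory.rev.obj p).len + 1)) (y : Fin (q.len + 1)) :
    (opInl p q).toOrderHom x ≤ (opInr p q).toOrderHom y :=
  below_inl_inr (𝟙 _) (𝟙 _) x y

/-- The retraction of `p^op * q` onto `q` sending `p^op` to the first element. -/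
def retrR (p q : SimplexCategory) : (opJoin.obj p).obj q ⟶ q :=
  desc (SimplexCategory.const _ _ 0) (𝟙 q) (fun _ _ ↦ Fin.zero_le _)

/-- The retraction of `p^op * q` onto `p^op` sending `q` to the last element. -/
def retrL (p q : SimplexCategory) : (opJoin.obj p).obj q ⟶ SimplexCategory.rev.obj p :=
  desc (𝟙 _) (SimplexCategory.const _ (SimplexCategory.rev.obj p) (Fin.last _))
    (fun _ _ ↦ Fin.le_last _)

@[simp]
theorem opInr_retrR : opInr p q ≫ retrR p q = 𝟙 q := inr_desc _ _ _

@[simp]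
theorem opInr_retrR_assoc {T : SimplexCategory} (k : _ ⟶ T) :
    opInr p q ≫ retrR p q ≫ k = (𝟙 q) ≫ k := by
  rw [← Category.assoc, opInr_retrR]

@[simp]
theorem opInl_retrR : opInl p q ≫ retrR p q = SimplexCategory.const _ _ 0 := inl_desc _ _ _

@[simp]
theorem opInl_retrR_assoc {T : SimplexCategory} (k : _ ⟶ T) :
    opInl p q ≫ retrR p q ≫ k = (SimplexCategory.const _ _ 0) ≫ k := by
  rw [← Category.assoc, opInl_retrR]

@[simp]
theorem opInl_retrL : opInl p q ≫ retrL p q = 𝟙 _ := inl_desc _ _ _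

@[simp]
theorem opInl_retrL_assoc {T : SimplexCategory} (k : _ ⟶ T) :
    opInl p q ≫ retrL p q ≫ k = (𝟙 _) ≫ k := by
  rw [← Category.assoc, opInl_retrL]

@[simp]
theorem opInr_retrL : opInr p q ≫ retrL p q =
    SimplexCategory.const _ (SimplexCategory.rev.obj p) (Fin.last _) := inr_desc _ _ _

@[simp]
theorem opInr_retrL_assoc {T : SimplexCategory} (k : _ ⟶ T) :
    opInr p q ≫ retrL p q ≫ k = (SimplexCategory.const _ (SimplexCategory.rev.obj p) (Fin.last _)) ≫ k := by
  rw [← Category.assoc, opInr_retrL]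

/-- The map `p^op ⟶ p^op * q` sending the elements with `τ = 0` to the first element of `q`. -/
def pushAux {p : SimplexCategory} (q : SimplexCategory) (τ : p ⟶ ⦋1⦌) :
    SimplexCategory.rev.obj p ⟶ (opJoin.obj p).obj q :=
  SimplexCategory.Hom.mk
    { toFun x := if τ.toOrderHom (Fin.rev x) = 0 then (opInr p q).toOrderHom 0
        else (opInl p q).toOrderHom x
      -- The elements of `p` with `τ = 0` form an initial segment, hence a final segment of `p^op`,
      -- next to `q` in the join. This is why they can be moved into `q` monotonically.
      monotone' x y h := by
        have hr : τ.toOrderHom (Fin.rev y) ≤ τ.toOrderHom (Fin.rev x) :=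
          τ.toOrderHom.monotone (Fin.rev_le_rev.2 h)
        have hxy : (opInl p q).toOrderHom x ≤ (opInr p q).toOrderHom 0 := opInl_le_opInr _ _
        dsimp only
        split_ifs with h₁ h₂ h₂
        · exact le_rfl
        · rw [h₁] at hr
          exact absurd (le_antisymm hr (Fin.zero_le _)) h₂
        · exact hxy
        · exact (opInl p q).toOrderHom.monotone h }

/-- The endomorphism of `p^op * q` sending the elements of `p^op` with `τ = 0` to the first
element of `q`. -/
def pushR {p : SimplexCategory} (q : SimplexCategory) (τ : p ⟶ ⦋1⦌) :
    (opJoin.obj p).obj q ⟶ (opJoin.obj p).obj q :=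
  desc (pushAux q τ) (opInr p q) (fun x y ↦ by
    change (if _ then _ else _) ≤ _
    split_ifs
    · exact (opInr p q).toOrderHom.monotone (Fin.zero_le _)
    · exact opInl_le_opInr _ _)

/-- The map `q ⟶ p^op * q` sending the elements with `τ = 0` to the last element of `p^op`. -/
def pullAux (p : SimplexCategory) {q : SimplexCategory} (τ : q ⟶ ⦋1⦌) :
    q ⟶ (opJoin.obj p).obj q :=
  SimplexCategory.Hom.mk
    { toFun x := if τ.toOrderHom x = 0 then (opInl p q).toOrderHom (Fin.last _)
        else (opInr p q).toOrderHom x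
      -- Here the elements with `τ = 0` are an initial segment of `q`, next to `p^op`, so no
      -- reversal enters.
      monotone' x y h := by
        have hr : τ.toOrderHom x ≤ τ.toOrderHom y := τ.toOrderHom.monotone h
        have hxy : (opInl p q).toOrderHom (Fin.last _) ≤ (opInr p q).toOrderHom y := opInl_le_opInr _ _
        dsimp only
        split_ifs with h₁ h₂ h₂
        · exact le_rfl
        · exact hxy
        · rw [h₂] at hr
          exact absurd (le_antisymm hr (Fin.zero_le _)) h₁
        · exact (opInr p q).toOrderHom.monotone h }

/-- The endomorphism of `p^op * q` sending the elements of `q` with `τ = 0` to the last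
element of `p^op`. -/
def pullL (p : SimplexCategory) {q : SimplexCategory} (τ : q ⟶ ⦋1⦌) :
    (opJoin.obj p).obj q ⟶ (opJoin.obj p).obj q :=
  desc (opInl p q) (pullAux p τ) (fun x y ↦ by
    change _ ≤ (if _ then _ else _)
    split_ifs
    · exact (opInl p q).toOrderHom.monotone (Fin.le_last _)
    · exact opInl_le_opInr _ _)

@[simp]
theorem opInl_pushR (τ : p ⟶ ⦋1⦌) : opInl p q ≫ pushR q τ = pushAux q τ := inl_desc _ _ _

@[simp]
theorem opInl_pushR_assoc (τ : p ⟶ ⦋1⦌) {T : SimplexCategory} (k : _ ⟶ T) :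
    opInl p q ≫ pushR q τ ≫ k = (pushAux q τ) ≫ k := by
  rw [← Category.assoc, opInl_pushR]

@[simp]
theorem opInr_pushR (τ : p ⟶ ⦋1⦌) : opInr p q ≫ pushR q τ = opInr p q := inr_desc _ _ _

@[simp]
theorem opInr_pushR_assoc (τ : p ⟶ ⦋1⦌) {T : SimplexCategory} (k : _ ⟶ T) :
    opInr p q ≫ pushR q τ ≫ k = (opInr p q) ≫ k := by
  rw [← Category.assoc, opInr_pushR]

@[simp]
theorem opInl_pullL (τ : q ⟶ ⦋1⦌) : opInl p q ≫ pullL p τ = opInl p q := inl_desc _ _ _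

@[simp]
theorem opInl_pullL_assoc (τ : q ⟶ ⦋1⦌) {T : SimplexCategory} (k : _ ⟶ T) :
    opInl p q ≫ pullL p τ ≫ k = (opInl p q) ≫ k := by
  rw [← Category.assoc, opInl_pullL]

@[simp]
theorem opInr_pullL (τ : q ⟶ ⦋1⦌) : opInr p q ≫ pullL p τ = pullAux p τ := inr_desc _ _ _

@[simp]
theorem opInr_pullL_assoc (τ : q ⟶ ⦋1⦌) {T : SimplexCategory} (k : _ ⟶ T) :
    opInr p q ≫ pullL p τ ≫ k = (pullAux p τ) ≫ k := by
  rw [← Category.assoc, opInr_pullL]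

theorem pushR_naturality {p' : SimplexCategory} (a : p' ⟶ p) (τ : p ⟶ ⦋1⦌) :
    pushR q (a ≫ τ) ≫ (opJoin.map a).app q = (opJoin.map a).app q ≫ pushR q τ := by
  apply opJoin_hom_ext
  · rw [opInl_pushR_assoc, opInl_map_app_assoc, Category.assoc, opInl_pushR]
    refine ConcreteCategory.hom_ext _ _ fun x ↦ ?_
    change ((opJoin.map a).app q).toOrderHom (if τ.toOrderHom (a.toOrderHom (Fin.rev x)) = 0 then
      _ else _) = if τ.toOrderHom (Fin.rev (Fin.rev (a.toOrderHom (Fin.rev x)))) = 0 then _ else _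
    -- `rev.map a` conjugates `a` by reversal; its outer reversal cancels the one in `pushAux`, so
    -- both sides test the same condition on `τ`.
    rw [Fin.rev_rev]
    split_ifs
    · exact ConcreteCategory.congr_hom (opInr_map_app a) 0
    · exact ConcreteCategory.congr_hom (opInl_map_app a) x
  · simp

theorem pullL_naturality {q' : SimplexCategory} (b : q' ⟶ q) (τ : q ⟶ ⦋1⦌) :
    pullL p (b ≫ τ) ≫ (opJoin.obj p).map b = (opJoin.obj p).map b ≫ pullL p τ := by
  apply opJoin_hom_ext
  · simp
  · rw [opInr_pullL_assoc, opInr_map_assoc, Category.assoc, opInr_pullL]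
    refine ConcreteCategory.hom_ext _ _ fun x ↦ ?_
    change ((opJoin.obj p).map b).toOrderHom (if τ.toOrderHom (b.toOrderHom x) = 0 then
      _ else _) = if τ.toOrderHom (b.toOrderHom x) = 0 then _ else _
    split_ifs
    · exact ConcreteCategory.congr_hom (opInl_map b) _
    · exact ConcreteCategory.congr_hom (opInr_map b) x

theorem pushR_zero : pushR q (SimplexCategory.const p ⦋1⦌ 0) = retrR p q ≫ opInr p q :=
  opJoin_hom_ext (by rw [opInl_pushR, opInl_retrR_assoc]; rfl) (by simp)

theorem pushR_one : pushR q (SimplexCategory.const p ⦋1⦌ 1) = 𝟙 _ :=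
  opJoin_hom_ext (by rw [opInl_pushR, Category.comp_id]; rfl) (by simp)

theorem pullL_zero : pullL p (SimplexCategory.const q ⦋1⦌ 0) = retrL p q ≫ opInl p q :=
  opJoin_hom_ext (by simp) (by rw [opInr_pullL, opInr_retrL_assoc]; rfl)

theorem pullL_one : pullL p (SimplexCategory.const q ⦋1⦌ 1) = 𝟙 _ :=
  opJoin_hom_ext (by simp) (by rw [opInr_pullL, Category.comp_id]; rfl)

end Join

open Join

/-! ### The objects `X(p^op * q)`, their two projections, and the décalage -/

section JoinDecalage

variable (C : Type u) [Category.{v} C]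

/-- The functor sending `X` to `(p, q) ↦ X(p^op * q)`. -/
def joinDec₁ : SimplicialObject C ⥤ SimplicialObject (SimplicialObject C) where
  obj X :=
    { obj p := (opJoin.obj p.unop).op ⋙ X
      map a := Functor.whiskerRight (NatTrans.op (opJoin.map a.unop)) X
      map_id p := by
        ext q
        change X.map ((opJoin.map (𝟙 p.unop)).app q.unop).op = 𝟙 _
        rw [opJoin.map_id]
        exact X.map_id _
      map_comp a b := by
        ext q
        change X.map ((opJoin.map (b.unop ≫ a.unop)).app q.unop).op = X.map _ ≫ X.map _
        rw [opJoin.map_comp, ← X.map_comp]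
        rfl }
  map f := { app p := Functor.whiskerLeft (opJoin.obj p.unop).op f
             naturality _ _ _ := by
               ext
               exact f.naturality _ }

/-- The functor sending `X` to `(q, p) ↦ X(p^op * q)`. -/
def joinDec₂ : SimplicialObject C ⥤ SimplicialObject (SimplicialObject C) where
  obj X :=
    { obj q := (opJoin.flip.obj q.unop).op ⋙ X
      map a := Functor.whiskerRight (NatTrans.op (opJoin.flip.map a.unop)) X
      map_id q := by
        ext p
        change X.map ((opJoin.obj p.unop).map (𝟙 q.unop)).op = 𝟙 _
        rw [(opJoin.obj p.unop).map_id]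
        exact X.map_id _
      map_comp a b := by
        ext p
        change X.map ((opJoin.obj p.unop).map (b.unop ≫ a.unop)).op = X.map _ ≫ X.map _
        rw [(opJoin.obj p.unop).map_comp, ← X.map_comp]
        rfl }
  map f := { app q := Functor.whiskerLeft (opJoin.flip.obj q.unop).op f
             naturality _ _ _ := by
               ext
               exact f.naturality _ }

variable {C} (X : SimplicialObject C)

/-- The projection `X(p^op * -) ⟶ X(p^op)`. -/
def projL (p : SimplexCategoryᵒᵖ) : ((joinDec₁ C).obj X).obj p ⟶
    (SimplicialObject.const C).obj ((SimplicialObject.opFunctor.obj X).obj p) where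
  app q := X.map (opInl p.unop q.unop).op
  naturality q q' b := by
    change X.map _ ≫ X.map _ = X.map _ ≫ 𝟙 _
    rw [Category.comp_id, ← X.map_comp]
    exact congrArg (fun k ↦ X.map (Quiver.Hom.op k)) (opInl_map b.unop)

/-- The section `X(p^op) ⟶ X(p^op * -)`. -/
def sectL (p : SimplexCategoryᵒᵖ) :
    (SimplicialObject.const C).obj ((SimplicialObject.opFunctor.obj X).obj p) ⟶
      ((joinDec₁ C).obj X).obj p where
  app q := X.map (retrL p.unop q.unop).op
  naturality q q' b := by
    change 𝟙 _ ≫ X.map _ = X.map _ ≫ X.map _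
    rw [Category.id_comp, ← X.map_comp]
    refine congrArg (fun k ↦ X.map (Quiver.Hom.op k)) (?_ : _ = (opJoin.obj p.unop).map b.unop ≫ _)
    exact opJoin_hom_ext (by simp) (by simp; rfl)

theorem sectL_projL (p : SimplexCategoryᵒᵖ) : sectL X p ≫ projL X p = 𝟙 _ := by
  ext q
  change X.map _ ≫ X.map _ = 𝟙 _
  rw [← X.map_comp, ← op_comp, opInl_retrL]
  exact X.map_id _

/-- `X(p^op * -)` contracts onto `X(p^op)`. -/
def homotopyL (p : SimplexCategoryᵒᵖ) : IntervalHomotopy (projL X p ≫ sectL X p) (𝟙 _) where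
  h q τ := X.map (pullL p.unop τ).op
  naturality b τ := by
    refine (X.map_comp _ _).symm.trans (Eq.trans ?_ (X.map_comp _ _))
    exact congrArg (fun k ↦ X.map (Quiver.Hom.op k)) (pullL_naturality b.unop τ)
  h_zero q := by
    rw [pullL_zero]
    exact X.map_comp _ _
  h_one q := by
    rw [pullL_one]
    exact X.map_id _

/-- The projection `X((-)^op * q) ⟶ X(q)`. -/
def projR (q : SimplexCategoryᵒᵖ) : ((joinDec₂ C).obj X).obj q ⟶
    (SimplicialObject.const C).obj (X.obj q) where
  app p := X.map (opInr p.unop q.unop).op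
  naturality p p' a := by
    change X.map _ ≫ X.map _ = X.map _ ≫ 𝟙 _
    rw [Category.comp_id, ← X.map_comp]
    exact congrArg (fun k ↦ X.map (Quiver.Hom.op k)) (opInr_map_app a.unop)

/-- The section `X(q) ⟶ X((-)^op * q)`. -/
def sectR (q : SimplexCategoryᵒᵖ) :
    (SimplicialObject.const C).obj (X.obj q) ⟶ ((joinDec₂ C).obj X).obj q where
  app p := X.map (retrR p.unop q.unop).op
  naturality p p' a := by
    change 𝟙 _ ≫ X.map _ = X.map _ ≫ X.map _
    rw [Category.id_comp, ← X.map_comp]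
    refine congrArg (fun k ↦ X.map (Quiver.Hom.op k)) (?_ : _ = (opJoin.map a.unop).app q.unop ≫ _)
    exact opJoin_hom_ext (by simp; rfl) (by simp)

theorem sectR_projR (q : SimplexCategoryᵒᵖ) : sectR X q ≫ projR X q = 𝟙 _ := by
  ext p
  change X.map _ ≫ X.map _ = 𝟙 _
  rw [← X.map_comp, ← op_comp, opInr_retrR]
  exact X.map_id _

/-- `X((-)^op * q)` contracts onto `X(q)`. -/
def homotopyR (q : SimplexCategoryᵒᵖ) : IntervalHomotopy (projR X q ≫ sectR X q) (𝟙 _) where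
  h p τ := X.map (pushR q.unop τ).op
  naturality a τ := by
    refine (X.map_comp _ _).symm.trans (Eq.trans ?_ (X.map_comp _ _))
    exact congrArg (fun k ↦ X.map (Quiver.Hom.op k)) (pushR_naturality a.unop τ)
  h_zero q := by
    rw [pushR_zero]
    exact X.map_comp _ _
  h_one q := by
    rw [pushR_one]
    exact X.map_id _

variable (C) in
/-- The décalage functor `X ↦ X([0] * -)`. -/
def dec : SimplicialObject C ⥤ SimplicialObject C :=
  joinDec₁ C ⋙ (evaluation _ _).obj (op ⦋0⦌)

variable (C) in
/-- The projection of the décalage. -/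
def decProj : dec C ⟶ 𝟭 (SimplicialObject C) where
  app X :=
    { app q := X.map (opInr ⦋0⦌ q.unop).op
      naturality q q' b := by
        refine (X.map_comp _ _).symm.trans (Eq.trans ?_ (X.map_comp _ _))
        exact congrArg (fun k ↦ X.map (Quiver.Hom.op k)) (opInr_map b.unop) }
  naturality X Y f := by
    ext q
    exact (f.naturality _).symm

/-- The splitting is the degeneracy repeating the first vertex. It is used only degree by degree:
that is enough for the décalage sequence to be exact. -/
theorem isSplitEpi_decProj_app (q : SimplexCategoryᵒᵖ) : IsSplitEpi (((decProj C).app X).app q) :=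
  ⟨⟨{ section_ := X.map (retrR ⦋0⦌ q.unop).op
      id := by
        refine (X.map_comp _ _).symm.trans ?_
        rw [← op_comp, opInr_retrR]
        exact X.map_id _ }⟩⟩

end JoinDecalage

/-! ### The diagonal preserves degreewise quasi-isomorphisms (S6) -/

section Diagonal

instance (A : Type u) [Category.{v} A] [Abelian A] : Abelian (SimplicialObject A) :=
  inferInstanceAs (Abelian (SimplexCategoryᵒᵖ ⥤ A))

theorem biDiag_preservesColimitsOfShape (C : Type u) [Category.{v} C] (J : Type u₁)
    [Category.{v₁} J] [HasColimitsOfShape J C] : PreservesColimitsOfShape J (biDiag C) :=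
  preservesColimitsOfShape_of_evaluation _ J fun n ↦
    inferInstanceAs (PreservesColimitsOfShape J
      ((evaluation SimplexCategoryᵒᵖ (SimplexCategoryᵒᵖ ⥤ C)).obj n ⋙
        (evaluation SimplexCategoryᵒᵖ C).obj n))

theorem biDiag_preservesLimitsOfShape (C : Type u) [Category.{v} C] (J : Type u₁)
    [Category.{v₁} J] [HasLimitsOfShape J C] : PreservesLimitsOfShape J (biDiag C) :=
  preservesLimitsOfShape_of_evaluation _ J fun n ↦
    inferInstanceAs (PreservesLimitsOfShape J
      ((evaluation SimplexCategoryᵒᵖ (SimplexCategoryᵒᵖ ⥤ C)).obj n ⋙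
        (evaluation SimplexCategoryᵒᵖ C).obj n))

instance (C : Type u) [Category.{v} C] [HasFiniteColimits C] :
    PreservesFiniteColimits (biDiag C) where
  preservesFiniteColimits J _ _ := biDiag_preservesColimitsOfShape C J

instance (C : Type u) [Category.{v} C] [HasFiniteLimits C] :
    PreservesFiniteLimits (biDiag C) where
  preservesFiniteLimits J _ _ := biDiag_preservesLimitsOfShape C J

variable {A : Type u} [Category.{v} A] [Abelian A]

instance : (biDiag A).PreservesZeroMorphisms := ⟨fun _ _ ↦ rfl⟩

/-- The contraction takes place in the outer direction and passes to the diagonal through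
`IntervalHomotopy.diag`. -/
theorem simplicialQuasiIso_biDiag_projL (X : SimplicialObject (SimplicialObject A))
    (p : SimplexCategoryᵒᵖ) : simplicialQuasiIso A ((biDiag A).map (projL X p)) :=
  simplicialQuasiIso_of_retraction (s := (biDiag A).map (sectL X p))
    (by rw [← (biDiag A).map_comp, sectL_projL, (biDiag A).map_id])
    (by simpa using (homotopyL X p).diag)

theorem simplicialQuasiIso_biDiag_projR (X : SimplicialObject (SimplicialObject A))
    (p : SimplexCategoryᵒᵖ) : simplicialQuasiIso A ((biDiag A).map (projR X p)) :=
  simplicialQuasiIso_of_retraction (s := (biDiag A).map (sectR X p))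
    (by rw [← (biDiag A).map_comp, sectR_projR, (biDiag A).map_id])
    (by simpa using (homotopyR X p).diag)

/-- In a commutative square with two opposite sides in a class with the two-out-of-three property,
the other sides are both in the class or both outside of it. -/
theorem mem_iff_of_square {D : Type u₁} [Category.{v₁} D] (W : MorphismProperty D)
    [W.HasTwoOutOfThreeProperty] {X Y X' Y' : D} {f : X ⟶ Y} {g : X' ⟶ Y'} {a : X ⟶ X'}
    {b : Y ⟶ Y'} (e : f ≫ b = a ≫ g) (ha : W a) (hb : W b) : W f ↔ W g := by
  rw [← W.postcomp_iff f b hb, e, W.precomp_iff a g ha]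

theorem simplicialQuasiIso_biDiag_const {X Y : SimplicialObject A} (f : X ⟶ Y)
    (hf : simplicialQuasiIso A f) :
    simplicialQuasiIso A ((biDiag A).map ((SimplicialObject.const _).map f)) := by
  have hA (X : SimplicialObject A) : simplicialQuasiIso A ((ΔtimesDiag A).hom.app X) :=
    MorphismProperty.of_isIso (simplicialQuasiIso A) _
  exact (mem_iff_of_square _ ((ΔtimesDiag A).hom.naturality f) (hA X) (hA Y)).2 hf

/-- The décalage retracts onto the constant object at outer degree zero, so only `f` in that degree
matters. -/
theorem simplicialQuasiIso_biDiag_dec {X Y : SimplicialObject (SimplicialObject A)} (f : X ⟶ Y)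
    (hf : ∀ n, simplicialQuasiIso A (f.app n)) :
    simplicialQuasiIso A ((biDiag A).map ((dec _).map f)) := by
  have e : (dec _).map f ≫ projL Y (op ⦋0⦌) = projL X (op ⦋0⦌) ≫
      (SimplicialObject.const _).map (f.app (op ⦋0⦌)) := by
    apply NatTrans.ext
    funext q
    exact (f.naturality _).symm
  exact (mem_iff_of_square _ ((((biDiag A).map_comp _ _).symm.trans ((biDiag A).congr_map e)).trans
    ((biDiag A).map_comp _ _)) (simplicialQuasiIso_biDiag_projL X (op ⦋0⦌))
    (simplicialQuasiIso_biDiag_projL Y (op ⦋0⦌))).2 (simplicialQuasiIso_biDiag_const _ (hf _))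

/-- The short exact sequence `0 ⟶ K ⟶ Dec X ⟶ X ⟶ 0`. -/
def decShortComplex (X : SimplicialObject (SimplicialObject A)) :
    ShortComplex (SimplicialObject (SimplicialObject A)) :=
  ShortComplex.mk (kernel.ι ((decProj _).app X)) ((decProj _).app X) (kernel.condition _)

theorem decShortComplex_shortExact (X : SimplicialObject (SimplicialObject A)) :
    (decShortComplex X).ShortExact where
  exact := ShortComplex.exact_kernel _
  mono_f := equalizer.ι_mono
  epi_g := by
    have (q : SimplexCategoryᵒᵖ) : Epi (((decProj _).app X).app q) :=
      have := isSplitEpi_decProj_app X q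
      inferInstance
    exact NatTrans.epi_of_epi_app ((decProj _).app X)

/-- The functoriality of `decShortComplex`. -/
def decShortComplexMap {X Y : SimplicialObject (SimplicialObject A)} (f : X ⟶ Y) :
    decShortComplex X ⟶ decShortComplex Y where
  τ₁ := kernel.map _ _ ((dec _).map f) f ((decProj _).naturality f).symm
  τ₂ := (dec _).map f
  τ₃ := f
  comm₁₂ := kernel.lift_ι _ _ _
  comm₂₃ := (decProj _).naturality f

/-- In outer degree `n`, the décalage map is `f` in outer degree `n + 1`, so the five lemma applies
to each row. The kernel map thus satisfies the hypothesis of (S6) again, which is what makes the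
induction run. -/
theorem decShortComplexMap_τ₁_app {X Y : SimplicialObject (SimplicialObject A)} (f : X ⟶ Y)
    (hf : ∀ n, simplicialQuasiIso A (f.app n)) (n : SimplexCategoryᵒᵖ) :
    simplicialQuasiIso A ((decShortComplexMap f).τ₁.app n) := by
  let G := (evaluation SimplexCategoryᵒᵖ (SimplicialObject A)).obj n
  exact quasiIsoOf_τ₁ (alternatingFaceMapComplex A) (G.mapShortComplex.map (decShortComplexMap f))
    ((decShortComplex_shortExact X).map_of_exact G) ((decShortComplex_shortExact Y).map_of_exact G)
    (hf _) (hf n)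

open HomologicalComplex in
-- Strong induction with `f` varying. The connecting map sends `H_n` of the quotient to `H_{n-1}` of
-- the kernel, where the induction hypothesis applies; in degree `0` there is no such term.
theorem isIso_homology_biDiag (n : ℕ) : ∀ {X Y : SimplicialObject (SimplicialObject A)} (f : X ⟶ Y)
    (_ : ∀ n, simplicialQuasiIso A (f.app n)),
    IsIso ((simplicialHomology A n).map ((biDiag A).map f)) := by
  induction n using Nat.strong_induction_on with
  | h n ih =>
  have hlt {j : ℕ} (hj : (ComplexShape.down ℕ).Rel n j) : j < n := by
    change j + 1 = n at hj
    omega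
  let N := biDiag A ⋙ alternatingFaceMapComplex A
  have hdec {X Y : SimplicialObject (SimplicialObject A)} (f : X ⟶ Y)
      (hf : ∀ n, simplicialQuasiIso A (f.app n)) (j : ℕ) :
      IsIso (homologyMap (N.map (decShortComplexMap f).τ₂) j) :=
    (simplicialQuasiIso_iff _).1 (simplicialQuasiIso_biDiag_dec f hf) j
  -- Surjectivity is proved for every `f` first: the four lemma for injectivity needs it in the same
  -- degree `n` for the kernel map, where the induction hypothesis says nothing.
  have hepi {X Y : SimplicialObject (SimplicialObject A)} (f : X ⟶ Y)
      (hf : ∀ n, simplicialQuasiIso A (f.app n)) : Epi (homologyMap (N.map f) n) := by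
    refine HomologySequence.epi_homologyMap_τ₃ (N.mapShortComplex.map (decShortComplexMap f))
      ((decShortComplex_shortExact X).map_of_exact N)
      ((decShortComplex_shortExact Y).map_of_exact N) n ?_ ?_ ?_
    · have := hdec f hf n
      exact inferInstanceAs (Epi (homologyMap (N.map (decShortComplexMap f).τ₂) n))
    · intro j hj
      have : IsIso (homologyMap (N.map (decShortComplexMap f).τ₁) j) :=
        ih j (hlt hj) _ (decShortComplexMap_τ₁_app f hf)
      exact inferInstanceAs (Epi (homologyMap (N.map (decShortComplexMap f).τ₁) j))
    · intro j hj
      have := hdec f hf j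
      exact inferInstanceAs (Mono (homologyMap (N.map (decShortComplexMap f).τ₂) j))
  intro X Y f hf
  have h₁ := hepi f hf
  have h₂ : Mono (homologyMap (N.map f) n) := by
    refine HomologySequence.mono_homologyMap_τ₃ (N.mapShortComplex.map (decShortComplexMap f))
      ((decShortComplex_shortExact X).map_of_exact N)
      ((decShortComplex_shortExact Y).map_of_exact N) n ?_ ?_ ?_
    · exact hepi _ (decShortComplexMap_τ₁_app f hf)
    · have := hdec f hf n
      exact inferInstanceAs (Mono (homologyMap (N.map (decShortComplexMap f).τ₂) n))
    · intro j hj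
      have : IsIso (homologyMap (N.map (decShortComplexMap f).τ₁) j) :=
        ih j (hlt hj) _ (decShortComplexMap_τ₁_app f hf)
      exact inferInstanceAs (Mono (homologyMap (N.map (decShortComplexMap f).τ₁) j))
  exact isIso_of_mono_of_epi (homologyMap (N.map f) n)

/-- The diagonal of a degreewise quasi-isomorphism is a quasi-isomorphism. -/
theorem simplicialQuasiIso_biDiag {X Y : SimplicialObject (SimplicialObject A)} (f : X ⟶ Y)
    (hf : ∀ n, simplicialQuasiIso A (f.app n)) : simplicialQuasiIso A ((biDiag A).map f) :=
  (simplicialQuasiIso_iff _).2 fun n ↦ isIso_homology_biDiag n f hf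

end Diagonal

/-! ### Reversing the outer simplicial direction (S8) -/

section Reverse

variable (C : Type u) [Category.{v} C]

/-- The projection from `(p, n) ↦ X(p^op * n)_n` to `(p, n) ↦ X(p^op)_n`. -/
def joinDec₁Proj : joinDec₁ (SimplicialObject C) ⋙ simp (biDiag C) ⟶
    _root_.SimplicialObject.opFunctor where
  app X :=
    { app p := (biDiag C).map (projL X p) ≫ (ΔtimesDiag C).hom.app _
      naturality p p' a := by
        ext n
        change (X.map ((opJoin.map a.unop).app n.unop).op).app n ≫
          (X.map (opInl p'.unop n.unop).op).app n ≫ 𝟙 _ =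
          ((X.map (opInl p.unop n.unop).op).app n ≫ 𝟙 _) ≫
            (X.map (SimplexCategory.rev.map a.unop).op).app n
        simp only [Category.comp_id, ← NatTrans.comp_app, ← X.map_comp, ← op_comp, opInl_map_app] }
  naturality X Y f := by
    ext p n
    change (f.app _).app n ≫ (Y.map (opInl p.unop n.unop).op).app n ≫ 𝟙 _ =
      ((X.map (opInl p.unop n.unop).op).app n ≫ 𝟙 _) ≫ (f.app _).app n
    simp only [Category.comp_id, ← NatTrans.comp_app, f.naturality]

/-- The projection from `(q, n) ↦ X(n^op * q)_n` to `(q, n) ↦ X(q)_n`. -/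
def joinDec₂Proj : joinDec₂ (SimplicialObject C) ⋙ simp (biDiag C) ⟶
    𝟭 (SimplicialObject (SimplicialObject C)) where
  app X :=
    { app q := (biDiag C).map (projR X q) ≫ (ΔtimesDiag C).hom.app _
      naturality q q' b := by
        ext n
        change (X.map ((opJoin.obj n.unop).map b.unop).op).app n ≫
          (X.map (opInr n.unop q'.unop).op).app n ≫ 𝟙 _ =
          ((X.map (opInr n.unop q.unop).op).app n ≫ 𝟙 _) ≫ (X.map b).app n
        simp only [Category.comp_id, ← NatTrans.comp_app, ← X.map_comp, ← op_comp, opInr_map]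
        rfl }
  naturality X Y f := by
    ext q n
    change (f.app _).app n ≫ (Y.map (opInr n.unop q.unop).op).app n ≫ 𝟙 _ =
      ((X.map (opInr n.unop q.unop).op).app n ≫ 𝟙 _) ≫ (f.app _).app n
    simp only [Category.comp_id, ← NatTrans.comp_app, f.naturality]

/-- Both iterated diagonals of `(p, q, n) ↦ X(p^op * q)_n` are `n ↦ X(n^op * n)_n`. -/
def joinDecDiagIso : (joinDec₁ (SimplicialObject C) ⋙ simp (biDiag C)) ⋙ biDiag C ≅
    (joinDec₂ (SimplicialObject C) ⋙ simp (biDiag C)) ⋙ biDiag C :=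
  NatIso.ofComponents (fun X ↦ NatIso.ofComponents
    (fun n ↦ Iso.refl ((X.obj (op ((opJoin.obj n.unop).obj n.unop))).obj n)) (fun {n m} a ↦ by
      change ((X.map ((opJoin.map a.unop).app n.unop).op).app n ≫
        (X.map ((opJoin.obj m.unop).map a.unop).op).app n ≫ (X.obj _).map a) ≫ 𝟙 _ =
        𝟙 _ ≫ (X.map ((opJoin.obj n.unop).map a.unop).op).app n ≫
        (X.map ((opJoin.map a.unop).app m.unop).op).app n ≫ (X.obj _).map a
      rw [Category.comp_id, Category.id_comp, ← NatTrans.comp_app_assoc,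
        ← NatTrans.comp_app_assoc, ← X.map_comp, ← X.map_comp, ← op_comp, ← op_comp,
        (opJoin.map a.unop).naturality]))
    (fun {X Y} f ↦ by
      ext n
      exact (Category.comp_id ((f.app _).app n)).trans (Category.id_comp ((f.app _).app n)).symm)

variable {C} {A : Type u} [Category.{v} A] [Abelian A]

/-- (S6) reduces the claim to a fixed `p`, so the contraction need not be natural in `p`; only the
projection is. -/
theorem simplicialQuasiIso_joinDec₁Proj (X : SimplicialObject (SimplicialObject A)) :
    simplicialQuasiIso A ((biDiag A).map ((joinDec₁Proj A).app X)) :=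
  simplicialQuasiIso_biDiag _ fun p ↦ (simplicialQuasiIso A).comp_mem _ _
    (simplicialQuasiIso_biDiag_projL X p) (MorphismProperty.of_isIso (simplicialQuasiIso A) _)

theorem simplicialQuasiIso_joinDec₂Proj (X : SimplicialObject (SimplicialObject A)) :
    simplicialQuasiIso A ((biDiag A).map ((joinDec₂Proj A).app X)) :=
  simplicialQuasiIso_biDiag _ fun p ↦ (simplicialQuasiIso A).comp_mem _ _
    (simplicialQuasiIso_biDiag_projR X p) (MorphismProperty.of_isIso (simplicialQuasiIso A) _)

/-- Reversing the outer simplicial direction does not change whether the diagonal of a morphism is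
a quasi-isomorphism. -/
theorem simplicialQuasiIso_biDiag_opFunctor_iff {X Y : SimplicialObject (SimplicialObject A)}
    (f : X ⟶ Y) :
    simplicialQuasiIso A ((biDiag A).map (_root_.SimplicialObject.opFunctor.map f)) ↔
      simplicialQuasiIso A ((biDiag A).map f) := by
  -- The three squares are the naturality squares of a zigzag from the diagonal of the reversed
  -- object, through `n ↦ X(n^op * n)_n`, to the diagonal of `X`.
  have h₁ := mem_iff_of_square _ ((Functor.whiskerRight (joinDec₁Proj A) (biDiag A)).naturality f)
    (simplicialQuasiIso_joinDec₁Proj X) (simplicialQuasiIso_joinDec₁Proj Y)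
  have h₂ := mem_iff_of_square _ ((Functor.whiskerRight (joinDec₂Proj A) (biDiag A)).naturality f)
    (simplicialQuasiIso_joinDec₂Proj X) (simplicialQuasiIso_joinDec₂Proj Y)
  have h₃ := mem_iff_of_square (simplicialQuasiIso A) ((joinDecDiagIso A).hom.naturality f)
    (MorphismProperty.of_isIso (simplicialQuasiIso A) _)
    (MorphismProperty.of_isIso (simplicialQuasiIso A) _)
  exact h₁.symm.trans (h₃.trans h₂)

end Reverse

/-! ### Contraction of the simplicial cylinder and inclusion of its ends -/

section CylinderHomotopy

variable {D : Type u} [Category.{v} D] [HasFiniteCoproducts D] (X : SimplicialObject D)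

theorem cyl₀_hom_ext {n : SimplexCategoryᵒᵖ} {T : D} {a b : (cyl₀ X).obj n ⟶ T}
    (h : ∀ σ, cylι X σ ≫ a = cylι X σ ≫ b) : a = b :=
  Sigma.hom_ext _ _ h

/-- The morphism out of a degree of the cylinder given by a morphism on each summand. -/
def cylDesc {n : SimplexCategoryᵒᵖ} {T : D} (k : (n.unop ⟶ ⦋1⦌) → (X.obj n ⟶ T)) :
    (cyl₀ X).obj n ⟶ T :=
  Sigma.desc k

theorem cylι_cylDesc {n : SimplexCategoryᵒᵖ} {T : D} (k : (n.unop ⟶ ⦋1⦌) → (X.obj n ⟶ T))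
    (σ : n.unop ⟶ ⦋1⦌) : cylι X σ ≫ cylDesc X k = k σ :=
  Sigma.ι_desc _ _

theorem cylι_map {n m : SimplexCategoryᵒᵖ} (a : n ⟶ m) (σ : n.unop ⟶ ⦋1⦌) :
    cylι X σ ≫ (cyl₀ X).map a = X.map a ≫ cylι X (a.unop ≫ σ) :=
  Sigma.ι_desc _ _

/-- The projection of the cylinder. -/
def cylProj : cyl₀ X ⟶ X where
  app n := cylDesc X fun _ ↦ 𝟙 _
  naturality n m a := by
    refine cyl₀_hom_ext X fun σ ↦ ?_
    rw [reassoc_of% cylι_map X a σ, cylι_cylDesc, reassoc_of% cylι_cylDesc]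
    simp

theorem cylIncl_cylProj (i : Fin 2) : cylIncl X i ≫ cylProj X = 𝟙 X := by
  ext n
  exact cylι_cylDesc X _ _

/-- The minimum of two simplices of `Δ[1]`. -/
def minMk₁ {n : SimplexCategory} (σ τ : n ⟶ ⦋1⦌) : n ⟶ ⦋1⦌ :=
  SimplexCategory.Hom.mk ⟨fun x ↦ min (σ.toOrderHom x) (τ.toOrderHom x), fun _ _ h ↦
    min_le_min (σ.toOrderHom.monotone h) (τ.toOrderHom.monotone h)⟩

/-- The cylinder contracts onto its end at the vertex `0`. -/
def cylHomotopy : IntervalHomotopy (cylProj X ≫ cylIncl X 0) (𝟙 (cyl₀ X)) where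
  -- The minimum `Δ[1] × Δ[1] ⟶ Δ[1]` is constant at `0` for `τ = 0` and the identity for `τ = 1`.
  h n τ := cylDesc X fun σ ↦ cylι X (minMk₁ σ τ)
  naturality {n m} a τ := by
    refine cyl₀_hom_ext X fun σ ↦ ?_
    rw [reassoc_of% cylι_map X a σ, cylι_cylDesc, reassoc_of% cylι_cylDesc, cylι_map]
    rfl
  h_zero n := by
    refine cyl₀_hom_ext X fun σ ↦ ?_
    change _ = cylι X σ ≫ cylDesc X (fun _ ↦ 𝟙 _) ≫ cylι X _
    rw [cylι_cylDesc, reassoc_of% cylι_cylDesc, Category.id_comp]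
    congr 1
    refine ConcreteCategory.hom_ext _ _ fun x ↦ ?_
    exact min_eq_right (Fin.zero_le _)
  h_one n := by
    refine cyl₀_hom_ext X fun σ ↦ ?_
    rw [cylι_cylDesc]
    refine Eq.trans ?_ (Category.comp_id _).symm
    congr 1
    refine ConcreteCategory.hom_ext _ _ fun x ↦ ?_
    exact min_eq_left (Fin.le_last _)

theorem inl_cylEnds : coprod.inl ≫ cylEnds X = cylIncl X 1 := coprod.inl_desc _ _

theorem inr_cylEnds : coprod.inr ≫ cylEnds X = cylIncl X 0 := coprod.inr_desc _ _

/-- The retraction sends every summand except the one at the constant `0` to the copy of `X` at the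
vertex `1`. It is constructed in a single degree, with no compatibility with faces required. -/
theorem isSplitMono_cylEnds_app (n : SimplexCategoryᵒᵖ) : IsSplitMono ((cylEnds X).app n) := by
  classical
  let r : (cyl₀ X).obj n ⟶ (X ⨿ X).obj n := cylDesc X fun σ ↦
    if σ = SimplexCategory.const _ _ 0 then (coprod.inr : X ⟶ X ⨿ X).app n
    else (coprod.inl : X ⟶ X ⨿ X).app n
  have ne : SimplexCategory.const n.unop ⦋1⦌ 1 ≠ SimplexCategory.const n.unop ⦋1⦌ 0 := fun e ↦ by
    have := congrArg (fun g ↦ SimplexCategory.Hom.toOrderHom g 0) e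
    exact absurd this (by simp [SimplexCategory.const])
  refine ⟨⟨{ retraction := r, id := coprod_app_ext ?_ ?_ }⟩⟩
  · rw [← Category.assoc, ← NatTrans.comp_app, inl_cylEnds, Category.comp_id]
    exact (cylι_cylDesc X _ _).trans (if_neg ne)
  · rw [← Category.assoc, ← NatTrans.comp_app, inr_cylEnds, Category.comp_id]
    exact (cylι_cylDesc X _ _).trans (if_pos rfl)

end CylinderHomotopy

/-- `F` is not assumed to preserve monomorphisms, but every functor preserves split ones, and
degreewise splitting suffices. -/
theorem mono_map_cylEnds {C : Type u} [Category.{v} C] {A : Type u₁} [Category.{v₁} A]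
    [HasFiniteColimits C] (F : C ⥤ A) (X : SimplicialObject (SimplicialObject C)) :
    Mono ((biDiag C ⋙ simp F).map (cylEnds X)) := by
  have (n : SimplexCategoryᵒᵖ) : Mono (((biDiag C ⋙ simp F).map (cylEnds X)).app n) := by
    have := isSplitMono_cylEnds_app X n
    exact inferInstanceAs (Mono (((evaluation SimplexCategoryᵒᵖ C).obj n ⋙ F).map
      ((cylEnds X).app n)))
  exact NatTrans.mono_of_mono_app _

/-! ### Equivalences detected by a functor `F` to an abelian category -/

section InverseImage

variable {C : Type u} [Category.{v} C] {A : Type u₁} [Category.{v₁} A] [Abelian A] (F : C ⥤ A)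

/-- The morphisms of simplicial objects sent to quasi-isomorphisms by `F`. -/
abbrev homologyEquiv : MorphismProperty (SimplicialObject C) :=
  (simplicialQuasiIso A).inverseImage (simp F)

/-- The homology functors invert the equivalences, hence factor through the localization, and
jointly they detect equivalences. -/
theorem homologyEquiv_saturated {X Y : SimplicialObject C} (f : X ⟶ Y) :
    homologyEquiv F f ↔ IsIso ((homologyEquiv F).Q.map f) := by
  refine ⟨fun h ↦ Localization.inverts (homologyEquiv F).Q (homologyEquiv F) f h, fun h ↦ ?_⟩
  refine (simplicialQuasiIso_iff _).2 fun n ↦ ?_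
  have hG : (homologyEquiv F).IsInvertedBy (simp F ⋙ simplicialHomology A n) :=
    fun _ _ g hg ↦ (simplicialQuasiIso_iff _).1 hg n
  exact (NatIso.isIso_map_iff (Localization.fac _ hG (homologyEquiv F).Q) f).1
    (inferInstanceAs (IsIso ((Localization.lift _ hG (homologyEquiv F).Q).map _)))

/-- The diagonal preserves degreewise equivalences. -/
theorem homologyEquiv_biDiag {X Y : SimplicialObject (SimplicialObject C)} (f : X ⟶ Y)
    (hf : ∀ n, homologyEquiv F (f.app n)) : homologyEquiv F ((biDiag C).map f) :=
  (mem_iff_of_square (simplicialQuasiIso A) ((diagSimp F).hom.naturality f)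
    (MorphismProperty.of_isIso (simplicialQuasiIso A) _)
    (MorphismProperty.of_isIso (simplicialQuasiIso A) _)).2
    (simplicialQuasiIso_biDiag ((simp (simp F)).map f) hf)

theorem homologyEquiv_biDiag_opFunctor_iff {X Y : SimplicialObject (SimplicialObject C)}
    (f : X ⟶ Y) :
    homologyEquiv F ((biDiag C).map (_root_.SimplicialObject.opFunctor.map f)) ↔
      homologyEquiv F ((biDiag C).map f) := by
  have h {X Y : SimplicialObject (SimplicialObject C)} (f : X ⟶ Y) :=
    mem_iff_of_square (simplicialQuasiIso A) ((diagSimp F).hom.naturality f)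
      (MorphismProperty.of_isIso (simplicialQuasiIso A) _)
      (MorphismProperty.of_isIso (simplicialQuasiIso A) _)
  exact (h _).trans ((simplicialQuasiIso_biDiag_opFunctor_iff ((simp (simp F)).map f)).trans
    (h f).symm)

variable [HasFiniteColimits C] [PreservesFiniteColimits F]

instance : PreservesFiniteColimits (simp F) where
  preservesFiniteColimits J _ _ :=
    inferInstanceAs (PreservesColimitsOfShape J ((Functor.whiskeringRight _ _ _).obj F))

theorem homologyEquiv_coprod_map {X Y X' Y' : SimplicialObject C} (f : X ⟶ Y) (g : X' ⟶ Y')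
    (hf : homologyEquiv F f) (hg : homologyEquiv F g) : homologyEquiv F (coprod.map f g) := by
  have hX := isIso_desc_of_isColimit
    (isColimitOfHasBinaryCoproductOfPreservesColimit (simp F) X X')
  have hY := isIso_desc_of_isColimit
    (isColimitOfHasBinaryCoproductOfPreservesColimit (simp F) Y Y')
  have hX' : simplicialQuasiIso A (biprod.desc ((simp F).map (coprod.inl : X ⟶ X ⨿ X'))
      ((simp F).map (coprod.inr : X' ⟶ X ⨿ X'))) :=
    MorphismProperty.of_isIso (simplicialQuasiIso A) _
  have hY' : simplicialQuasiIso A (biprod.desc ((simp F).map (coprod.inl : Y ⟶ Y ⨿ Y'))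
      ((simp F).map (coprod.inr : Y' ⟶ Y ⨿ Y'))) :=
    MorphismProperty.of_isIso (simplicialQuasiIso A) _
  refine (mem_iff_of_square (simplicialQuasiIso A) ?_ hX' hY').1
    (quasiIsoOf_biprod_map _ _ _ hf hg)
  apply biprod.hom_ext'
  · rw [biprod.inl_map_assoc, biprod.inl_desc, biprod.inl_desc_assoc, ← (simp F).map_comp,
      ← (simp F).map_comp, coprod.inl_map]
  · rw [biprod.inr_map_assoc, biprod.inr_desc, biprod.inr_desc_assoc, ← (simp F).map_comp,
      ← (simp F).map_comp, coprod.inr_map]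

/-- The inclusion of the final object in the cone of `f` is an equivalence if and only if
`f` is. -/
theorem homologyEquiv_cone_iff [HasTerminal (SimplicialObject C)] {X Y : SimplicialObject C}
    (f : X ⟶ Y) :
    homologyEquiv F f ↔ homologyEquiv F (terminal.from ((biDiag C).obj
      (cone ((SimplicialObject.const (SimplicialObject C)).map f)))) := by
  let G := biDiag C ⋙ simp F
  let cf := (SimplicialObject.const (SimplicialObject C)).map f
  let cX := (SimplicialObject.const (SimplicialObject C)).obj X
  let cY := (SimplicialObject.const (SimplicialObject C)).obj Y
  let T := (SimplicialObject.const (SimplicialObject C)).obj (⊤_ (SimplicialObject C))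
  let e : cX ⟶ T := { app n := terminal.from (cX.obj n) }
  have sq : IsPushout (cylEnds cX) (coprod.map cf e) (pushout.inl _ _) (pushout.inr _ _) :=
    IsPushout.of_hasPushout _ _
  have hmono : Mono (G.map (cylEnds cX)) := mono_map_cylEnds F cX
  have hmono' : Mono (G.map (coprod.inr : cX ⟶ cX ⨿ cX)) := by
    have : IsSplitMono (coprod.inr : cX ⟶ cX ⨿ cX) := ⟨⟨coprod.desc (𝟙 _) (𝟙 _), coprod.inr_desc _ _⟩⟩
    infer_instance
  have hi : simplicialQuasiIso A (G.map (coprod.inr : cX ⟶ cX ⨿ cX) ≫ G.map (cylEnds cX)) := by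
    rw [← G.map_comp, inr_cylEnds]
    refine simplicialQuasiIso_of_section (r := G.map (cylProj cX)) ?_ ?_
    · rw [← G.map_comp, cylIncl_cylProj, G.map_id]
    · rw [← G.map_comp, ← G.map_id]
      exact ((cylHomotopy cX).diag).map F
  have key := quasiIsoOf_doubleCylinder_iff (alternatingFaceMapComplex A)
    (isColimitOfHasBinaryCoproductOfPreservesColimit G cX cX)
    (isColimitOfHasBinaryCoproductOfPreservesColimit G cY T)
    (f := G.map cf) (e := G.map e)
    (by rw [← G.map_comp, ← G.map_comp, coprod.inl_map])
    (by rw [← G.map_comp, ← G.map_comp, coprod.inr_map])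
    (sq.map G) hi
  rw [← G.map_comp] at key
  have h₁ : simplicialQuasiIso A (G.map cf) ↔ homologyEquiv F f :=
    mem_iff_of_square (homologyEquiv F) ((ΔtimesDiag C).hom.naturality f)
      (MorphismProperty.of_isIso (homologyEquiv F) _)
      (MorphismProperty.of_isIso (homologyEquiv F) _)
  -- `F` need not send the final object to zero, so acyclicity of the cone is read through its
  -- vertex `t`: followed by the map to the final object it is an isomorphism on diagonals, and
  -- two-out-of-three applies.
  let t : T ⟶ cone cf := coprod.inr ≫ pushout.inr _ _
  have ht : (biDiag C).map t ≫ terminal.from ((biDiag C).obj (cone cf)) =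
      (ΔtimesDiag C).hom.app (⊤_ (SimplicialObject C)) := Subsingleton.elim _ _
  have ht' : homologyEquiv F ((biDiag C).map t ≫ terminal.from ((biDiag C).obj (cone cf))) := by
    rw [ht]
    exact MorphismProperty.of_isIso (homologyEquiv F) _
  refine h₁.symm.trans (key.symm.trans ?_)
  exact ⟨fun h ↦ (MorphismProperty.precomp_iff _ (W' := homologyEquiv F) _ _ h).1 ht',
    fun h ↦ (MorphismProperty.postcomp_iff _ (W' := homologyEquiv F) _ _ h).1 ht'⟩

end InverseImage

/-! ### Coherence axioms and assembly of the descent structure -/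

section Localized

variable {C : Type u₁} [Category.{v₁} C] {D : Type u₂} [Category.{v₂} D]
  {C' : Type u₃} [Category.{v₃} C'] {D' : Type u₄} [Category.{v₄} D']

/-- As `μ` and `Θ` below come from actual natural transformations, this and the next lemma bring
every coherence equation back to the functor category, where it is checked on components. -/
theorem locPrecomp_locNat {E : MorphismProperty D} {F F' : C ⥤ D} (G : C' ⥤ C) (τ : F ⟶ F') :
    locPrecomp G (locNat E τ) = locNat E (Functor.whiskerLeft G τ) :=
  locMap_Q_map _ _ _

theorem locPostcomp_locNat {E : MorphismProperty D} {E' : MorphismProperty D'} {F F' : C ⥤ D}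
    (G : D ⥤ D') (h : ∀ ⦃X Y : D⦄ (f : X ⟶ Y), E f → E' (G.map f)) (τ : F ⟶ F') :
    locPostcomp G h (locNat E τ) = locNat E' (Functor.whiskerRight τ G) :=
  locMap_Q_map _ _ _

end Localized

section Main

variable {C : Type u} [Category.{v} C] {A : Type u₁} [Category.{v₁} A] [Abelian A] (F : C ⥤ A)

theorem diagData_compat₁ (W : MorphismProperty (SimplicialObject C)) :
    (diagData W).compat₁ = 𝟙 (locFun W (biDiag C)) := by
  unfold DescentData.compat₁
  have h : locPrecomp (Δtimes (SimplicialObject C)) (diagData W).mu =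
    locNat W (Functor.whiskerLeft (Δtimes (SimplicialObject C)) (diagMu C).hom) :=
    locPrecomp_locNat _ _
  rw [h]
  refine Eq.trans ?_ ((W.functorCategory _).Q.map_id (biDiag C))
  refine Eq.trans ?_ (congrArg _ (?_ : Functor.whiskerRight (ΔtimesDiag (SimplicialObject C)).inv
    (biDiag C) ≫ Functor.whiskerLeft (Δtimes (SimplicialObject C)) (diagMu C).hom ≫
    Functor.whiskerRight (constSimp (biDiag C)).hom (biDiag C) ≫
    Functor.whiskerLeft (biDiag C) (diagLam C).hom = 𝟙 (biDiag C)))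
  · simp only [Functor.map_comp]
    rfl
  · ext X n : 4
    exact (Category.id_comp _).trans ((Category.id_comp _).trans (Category.id_comp _))

theorem diagData_compat₂ (W : MorphismProperty (SimplicialObject C)) :
    (diagData W).compat₂ = 𝟙 (locFun W (biDiag C)) := by
  unfold DescentData.compat₂
  have h : locPrecomp (timesΔ (SimplicialObject C)) (diagData W).mu =
    locNat W (Functor.whiskerLeft (timesΔ (SimplicialObject C)) (diagMu C).hom) :=
    locPrecomp_locNat _ _
  rw [h]
  refine Eq.trans ?_ ((W.functorCategory _).Q.map_id (biDiag C))
  refine Eq.trans ?_ (congrArg _ (?_ : Functor.whiskerRight (timesΔDiag (SimplicialObject C)).inv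
    (biDiag C) ≫ Functor.whiskerLeft (timesΔ (SimplicialObject C)) (diagMu C).hom ≫
    Functor.whiskerRight ((SimplicialObject.whiskering _ _).map (diagLam C).hom) (biDiag C) =
      𝟙 (biDiag C)))
  · exact ((Functor.map_comp _ _ _).trans (congrArg _ (Functor.map_comp _ _ _))).symm
  · ext X n : 4
    exact (Category.id_comp _).trans (Category.id_comp _)

variable [HasFiniteColimits C] [PreservesFiniteColimits F]

theorem isSimplicialDescent_diagData_homologyEquiv [HasTerminal (SimplicialObject C)] :
    IsSimplicialDescent (diagData (homologyEquiv F)) where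
  hasFiniteCoproducts := inferInstance
  hasTerminal := inferInstance
  saturated := homologyEquiv_saturated F
  coprod_map := homologyEquiv_coprod_map F
  simple_coprod X Y := by
    have : IsIso (coprodComparison (biDiag C) X Y) := inferInstance
    exact MorphismProperty.of_isIso (homologyEquiv F) (coprodComparison (biDiag C) X Y)
  isIso_mu := inferInstanceAs
    (IsIso (((homologyEquiv F).functorCategory _).Q.map (diagMu C).hom))
  lam_mem X := MorphismProperty.of_isIso (homologyEquiv F) ((diagLam C).hom.app X)
  exists_section := ⟨(diagLam C).inv, (diagLam C).inv_hom_id⟩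
  compat₁ := diagData_compat₁ _
  compat₂ := diagData_compat₂ _
  exact := homologyEquiv_biDiag F
  acyclic := homologyEquiv_cone_iff F
  inverse_order := homologyEquiv_biDiag_opFunctor_iff F

end Main

/-! ### Compatibility of degreewise functors with `λ` and `μ` -/

section DescentFunctor

variable {C : Type u} [Category.{v} C] {C' : Type u₁} [Category.{v₁} C'] (F : C ⥤ C')
  (W : MorphismProperty (SimplicialObject C)) (W' : MorphismProperty (SimplicialObject C'))

/-- The isomorphism between the diagonal of `F` and `F` of the diagonal. -/
abbrev diagTheta : locFun W' (biDiag C ⋙ simp F) ⟶ locFun W' (simp (simp F) ⋙ biDiag C') :=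
  locNat W' (diagSimp F).hom

theorem compatLam_diagTheta :
    CompatLam (diagData W) (diagData W') (simp F) (diagTheta F W') := by
  unfold CompatLam
  have h : locPrecomp (SimplicialObject.const (SimplicialObject C)) (diagTheta F W') =
      locNat W' (Functor.whiskerLeft (SimplicialObject.const (SimplicialObject C))
        (diagSimp F).hom) := locPrecomp_locNat _ _
  refine Eq.trans (congrArg (· ≫ _) h) ?_
  refine Eq.trans ?_ (congrArg (W'.functorCategory _).Q.map
    (?_ : Functor.whiskerLeft (SimplicialObject.const (SimplicialObject C))
        (diagSimp F).hom ≫ Functor.whiskerRight (constSimp (simp F)).hom (biDiag C') ≫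
        Functor.whiskerLeft (simp F) (diagLam C').hom =
      Functor.whiskerRight (diagLam C).hom (simp F)))
  · exact ((Functor.map_comp _ _ _).trans (congrArg _ (Functor.map_comp _ _ _))).symm
  · ext X n : 4
    exact (Category.id_comp _).trans ((Category.id_comp _).trans (F.map_id _).symm)

theorem compatMu_diagTheta
    (hF : ∀ ⦃X Y : SimplicialObject C⦄ (f : X ⟶ Y), W f → W' ((simp F).map f))
    (hW' : ∀ {X Y : SimplicialObject (SimplicialObject C')} (f : X ⟶ Y),
      (∀ n : SimplexCategoryᵒᵖ, W' (f.app n)) → W' ((biDiag C').map f)) :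
    CompatMu (diagData W) (diagData W') (simp F) (diagTheta F W') hF hW' := by
  unfold CompatMu
  have h₁ : locPrecomp (biDiag (SimplicialObject C)) (diagTheta F W') =
      locNat W' (Functor.whiskerLeft (biDiag (SimplicialObject C)) (diagSimp F).hom) :=
    locPrecomp_locNat _ _
  have h₂ : locPrecomp (simp (simp (simp F))) (diagData W').mu =
      locNat W' (Functor.whiskerLeft (simp (simp (simp F))) (diagMu C').hom) :=
    locPrecomp_locNat _ _
  have h₃ : locPostcomp (simp F) hF (diagData W).mu =
      locNat W' (Functor.whiskerRight (diagMu C).hom (simp F)) := locPostcomp_locNat _ _ _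
  have h₄ : locPrecomp (simp (biDiag C)) (diagTheta F W') =
      locNat W' (Functor.whiskerLeft (simp (biDiag C)) (diagSimp F).hom) :=
    locPrecomp_locNat _ _
  have h₅ := locMap_Q_map (W := W'.functorCategory (SimplicialObject (SimplicialObject C)))
    (W' := W'.functorCategory (SimplicialObject (SimplicialObject (SimplicialObject C))))
    (simpleAfter (SimplicialObject C) (biDiag C'))
    (fun _ _ _ hf Z ↦ hW' _ (fun n ↦ hf (Z.obj n))) (diagSimp F).hom
  refine Eq.trans (congrArg₂ (· ≫ _ ≫ ·) h₁ h₂) (Eq.trans ?_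
    (congrArg₂ (· ≫ ·) h₃ (congrArg₂ (· ≫ ·) h₄ h₅)).symm)
  have key : Functor.whiskerLeft (biDiag (SimplicialObject C)) (diagSimp F).hom ≫
      Functor.whiskerRight (diagSimp (simp F)).hom (biDiag C') ≫
      Functor.whiskerLeft (simp (simp (simp F))) (diagMu C').hom =
    Functor.whiskerRight (diagMu C).hom (simp F) ≫
      Functor.whiskerLeft (simp (biDiag C)) (diagSimp F).hom ≫
      (simpleAfter (SimplicialObject C) (biDiag C')).map (diagSimp F).hom := by
    ext X n : 4
    have e (T : C) : 𝟙 (F.obj T) ≫ 𝟙 _ ≫ 𝟙 _ = F.map (𝟙 T) ≫ 𝟙 (F.obj T) ≫ 𝟙 _ := by simp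
    exact e _
  have h := congrArg (W'.functorCategory _).Q.map key
  exact ((Functor.map_comp _ _ _).trans (congrArg _ (Functor.map_comp _ _ _))).symm.trans
    (h.trans ((Functor.map_comp _ _ _).trans (congrArg _ (Functor.map_comp _ _ _))))

end DescentFunctor

/-! ### Simplicial sets and simplicial modules -/

section FreeModules

universe w

variable (R : Type w) [Ring R]

instance : PreservesFiniteColimits (ModuleCat.free R) :=
  have := (ModuleCat.adj R).leftAdjoint_preservesColimits
  inferInstance

theorem isSimplicialDescent_homologyIso : IsSimplicialDescent (diagData (homologyIso R)) :=
  isSimplicialDescent_diagData_homologyEquiv (ModuleCat.free R)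

theorem isSimplicialDescent_moduleQuasiIso :
    IsSimplicialDescent (diagData (moduleQuasiIso R)) :=
  -- The inverse image of the quasi-isomorphisms under the degreewise identity functor unfolds to
  -- the quasi-isomorphisms.
  isSimplicialDescent_diagData_homologyEquiv (𝟭 (ModuleCat R))

theorem isDescentFunctor_freeSimplicialModule :
    IsDescentFunctor (isSimplicialDescent_homologyIso R) (isSimplicialDescent_moduleQuasiIso R)
      (freeSimplicialModule R) where
  -- Equivalences of simplicial sets are by definition the inverse image under `L` of those of
  -- simplicial modules.
  map_mem _ _ _ hf := hf
  coprod_mem X Y := by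
    have : IsIso (coprodComparison (freeSimplicialModule R) X Y) := inferInstance
    exact MorphismProperty.of_isIso (simplicialQuasiIso (ModuleCat R))
      (coprodComparison (freeSimplicialModule R) X Y)
  exists_iso := ⟨diagTheta (ModuleCat.free R) (moduleQuasiIso R),
    inferInstanceAs (IsIso (((moduleQuasiIso R).functorCategory _).Q.map
      (diagSimp (ModuleCat.free R)).hom)),
    compatLam_diagTheta _ _ _, compatMu_diagTheta _ _ _ _ _⟩

end FreeModules

end SimplicialDescent
end

theorem mainTheorem6 (R : Type*) [Ring R] :
    ∃ (hSet : SimplicialDescent.IsSimplicialDescent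
          (SimplicialDescent.diagData (SimplicialDescent.homologyIso R)))
      (hMod : SimplicialDescent.IsSimplicialDescent
          (SimplicialDescent.diagData (SimplicialDescent.moduleQuasiIso R))),
      SimplicialDescent.IsDescentFunctor hSet hMod
        (SimplicialDescent.freeSimplicialModule R) :=
  ⟨_, _, SimplicialDescent.isDescentFunctor_freeSimplicialModule R⟩
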